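/- For every fixed real $\varepsilon>0$ there is a static data structure in the word RAM model that stores any set $P$ of at most $n$ points on the $n\times n$ grid $\{1,\dots,n\}\times\{1,\dots,n\}$, uses $O(n\log^2 n)$ words of space, and supports approximate two-dimensional orthogonal range counting queries in $O(\log\log n)$ worst-case time: given a query rectangle $Q=[a,b]\times[c,d]$ with $a,b,c,d\in\{1,\dots,n\}$, it returns an integer $k'$ such that $(1-\varepsilon)k\le k'\le(1+\varepsilon)k$, where $k=|P\cap Q|$. (In particular $k'=0$ if $k=0$.) More precisely: for every $\varepsilon>0$ there are a constant $C$ and a deterministic word RAM program, both depending only on $\varepsilon$, such that for every $n\ge 3$, every word length $w$ for which addresses up to the space bound fit into a word, that is, $C\,n\log^2 n\le 2^w$, and every such $P$, there is a memory content of at most $C\,n\log^2 n$ words of $w$ bits on which the program, started with $a,b,c,d$ in four of its registers and $0$ in the others, halts after at most $C\log\log n$ unit-cost steps (addition, subtraction, multiplication, bitwise operations, shifts, loading a constant, memory reads and writes, conditional jumps), leaves the memory as it was before the query, and outputs such a $k'$. -/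

import Mathlib

/-! A word RAM: unit-cost operations on `w`-bit words, constantly many registers (those that the
finite program mentions) and a memory of exactly `S` words, indexed `0, …, S - 1`. -/

namespace WordRAM

/-- The binary word operations. -/
inductive BinOp
  | add | sub | mul | and | or | xor | shl | shr

/-- Arithmetic is modulo `2 ^ w`; shifting by `w` or more places gives `0`. -/
def BinOp.eval {w : ℕ} : BinOp → BitVec w → BitVec w → BitVec w
  | .add, x, y => x + y
  | .sub, x, y => x - y
  | .mul, x, y => x * y
  | .and, x, y => x &&& y
  | .or,  x, y => x ||| y
  | .xor, x, y => x ^^^ y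
  | .shl, x, y => x <<< y.toNat
  | .shr, x, y => x >>> y.toNat

/-- Instructions; the arguments `dst`, `src`, `addr`, `x`, `y` are register numbers. -/
inductive Instr
  /-- `dst := k` (modulo `2 ^ w`) -/
  | const (dst k : ℕ)
  /-- `dst := x op y` -/
  | op (o : BinOp) (dst x y : ℕ)
  /-- `dst := memory[addr]` -/
  | load (dst addr : ℕ)
  /-- `memory[addr] := src` -/
  | store (addr src : ℕ)
  /-- go to instruction number `target` if `x < y` (unsigned comparison) -/
  | jumpLt (x y target : ℕ)
  /-- go to instruction number `target` if `x = y` -/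
  | jumpEq (x y target : ℕ)
  /-- stop -/
  | halt

/-- Programs are finite and do not depend on the input or on the word length. -/
abbrev Program := List Instr

/-- A configuration of a machine with word length `w` and `S` words of memory. -/
structure Config (w S : ℕ) where
  pc : ℕ
  reg : ℕ → BitVec w
  mem : Fin S → BitVec w

/-- One step. There is no next configuration after `halt`, after a memory access outside of
`0, …, S - 1`, or when the program counter has left the program. -/
def step {w S : ℕ} (p : Program) (c : Config w S) : Option (Config w S) :=
  match p[c.pc]? with
  | none => none
  | some .halt => none
  | some (.const dst k) =>
      some ⟨c.pc + 1, Function.update c.reg dst (BitVec.ofNat w k), c.mem⟩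
  | some (.op o dst x y) =>
      some ⟨c.pc + 1, Function.update c.reg dst (o.eval (c.reg x) (c.reg y)), c.mem⟩
  | some (.load dst addr) =>
      if h : (c.reg addr).toNat < S then
        some ⟨c.pc + 1, Function.update c.reg dst (c.mem ⟨(c.reg addr).toNat, h⟩), c.mem⟩
      else none
  | some (.store addr src) =>
      if h : (c.reg addr).toNat < S then
        some ⟨c.pc + 1, c.reg, Function.update c.mem ⟨(c.reg addr).toNat, h⟩ (c.reg src)⟩
      else none
  | some (.jumpLt x y target) =>
      some ⟨if c.reg x < c.reg y then target else c.pc + 1, c.reg, c.mem⟩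
  | some (.jumpEq x y target) =>
      some ⟨if c.reg x = c.reg y then target else c.pc + 1, c.reg, c.mem⟩

/-- The configuration after `t` steps, if the machine can make that many steps. -/
def stepN {w S : ℕ} (p : Program) : ℕ → Config w S → Option (Config w S)
  | 0, c => some c
  | t + 1, c => (step p c).bind (stepN p t)

/-- The start of a query with arguments `a, b, c, d`: they are in registers `0, 1, 2, 3`, the
other registers are `0`, and the memory holds the data structure. -/
def queryStart {w S : ℕ} (mem : Fin S → BitVec w) (a b c d : ℕ) : Config w S where
  pc := 0
  reg := fun r => match r with
    | 0 => BitVec.ofNat w a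
    | 1 => BitVec.ofNat w b
    | 2 => BitVec.ofNat w c
    | 3 => BitVec.ofNat w d
    | _ => 0
  mem := mem

/-- On the data structure `mem`, the program `p` answers the query `a, b, c, d` with the number
`k` (left in register `0`) in at most `T` steps. The memory is the same after the query as before
it, so that the next query finds the data structure intact. -/
def Answers {w S : ℕ} (p : Program) (mem : Fin S → BitVec w) (a b c d : ℕ) (T : ℝ) (k : ℕ) :
    Prop :=
  ∃ (t : ℕ) (final : Config w S), (t : ℝ) ≤ T ∧
    stepN p t (queryStart mem a b c d) = some final ∧
    p[final.pc]? = some Instr.halt ∧ final.mem = mem ∧ (final.reg 0).toNat = k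

end WordRAM

/-- The number of points of `P` in the rectangle `[a, b] × [c, d]`. -/
def rangeCount (P : Finset (ℕ × ℕ)) (a b c d : ℕ) : ℕ :=
  (P ∩ (Finset.Icc a b ×ˢ Finset.Icc c d)).card

/-! Stretch all coordinates by 4, so that points and query bounds have different residues, and
regard them as leaves of complete binary trees. The root paths of the two ends of an interval
separate at a unique level. The interval is therefore the disjoint union of a part to the right of
the lower end, inside one node, and a part to the left of the upper end, inside the sibling node. A
rectangle thus splits into four two-sided queries, each inside one cell, that is, among the points
below a pair of nodes. With a copy of the point set for each quarter turn, all four take the form `A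
< x`, `C < y` (`rangeCount_eq_sum`).

For each pair of heights a point lies in one cell, so the nonempty cells together have `O(n log² n)`
elements. Each cell can afford a table linear in its size, and its record is found in constant time
by displacement hashing (`exists_perfect_hash`).

In a cell, order the points by first coordinate and distinguish the counts of a floating point scale
with `s`-bit mantissas. For counts with exponent `j`, only starting positions divisible by `2 ^ j`
are kept. For each such position and count the table stores the threshold on `C` up to which the
count is reached. The sizes for the various `j` form a geometric series. Rounding the start admits
fewer than `2 ^ j` extra points, and `2 ^ j` is also the gap in the scale, so any `i` such that
count `i` is reached and count `i + 1` is not gives relative error at most `4 / 2 ^ s`, and an exact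
answer for `j = 0` (`scale_approx`).

The starting position is the rank of `A` in the cell. Among the ancestors of `A` there are
consecutive ones, the lower with an empty cell and the upper with a nonempty cell. The rank of `A`
is then that of an end of the range of the upper one, which is stored
(`rankBelow_eq_of_cell_empty`).

Split levels, ranks and counts are all found by binary search over ranges of length `O(2 ^ s log
n)`, hence in `O(log log n)` steps. `exists_layout` provides the memory, and `exec_query` verifies
the query in a small structured language whose compiled code never stores to memory. -/

namespace WordRAM

/-! ### Compiling expressions to the word RAM -/

/-- Side-effect free word expressions; variables are registers below `32`. -/
inductive Expr
  | var (r : ℕ)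
  | lit (k : ℕ)
  | load (e : Expr)
  | bin (o : BinOp) (x y : Expr)

/-- The binary operations on natural numbers. -/
def BinOp.natEval : BinOp → ℕ → ℕ → ℕ
  | .add, x, y => x + y
  | .sub, x, y => x - y
  | .mul, x, y => x * y
  | .and, x, y => x &&& y
  | .or,  x, y => x ||| y
  | .xor, x, y => x ^^^ y
  | .shl, x, y => x * 2 ^ y
  | .shr, x, y => x / 2 ^ y

/-- Condition under which a word operation agrees with the operation on natural numbers. -/
def BinOp.NoOverflow (w : ℕ) : BinOp → ℕ → ℕ → Prop
  | .add, x, y => x + y < 2 ^ w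
  | .sub, x, y => y ≤ x
  | .mul, x, y => x * y < 2 ^ w
  | .shl, x, y => x * 2 ^ y < 2 ^ w
  | .and, _, _ => True
  | .or, _, _ => True
  | .xor, _, _ => True
  | .shr, _, _ => True

theorem BinOp.toNat_eval {w : ℕ} (o : BinOp) (x y : BitVec w)
    (h : o.NoOverflow w x.toNat y.toNat) :
    (o.eval x y).toNat = o.natEval x.toNat y.toNat := by
  cases o
  · exact BitVec.toNat_add_of_lt h
  · exact BitVec.toNat_sub_of_le h
  · exact BitVec.toNat_mul_of_lt h
  · exact BitVec.toNat_and _ _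
  · exact BitVec.toNat_or _ _
  · exact BitVec.toNat_xor _ _
  · simp only [NoOverflow] at h
    simp only [eval, natEval, BitVec.toNat_shiftLeft, Nat.shiftLeft_eq]
    exact Nat.mod_eq_of_lt h
  · simp [eval, natEval, BitVec.toNat_ushiftRight, Nat.shiftRight_eq_div_pow]

/-- The value of an expression, given the memory and the variables as natural numbers. -/
def Expr.eval (m s : ℕ → ℕ) : Expr → ℕ
  | .var r => s r
  | .lit k => k
  | .load e => m (e.eval m s)
  | .bin o x y => o.natEval (x.eval m s) (y.eval m s)

/-- The evaluation of an expression neither overflows nor reads outside of the memory. -/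
def Expr.Safe (w S : ℕ) (m s : ℕ → ℕ) : Expr → Prop
  | .var r => r < 32
  | .lit k => k < 2 ^ w
  | .load e => e.Safe w S m s ∧ e.eval m s < S
  | .bin o x y => x.Safe w S m s ∧ y.Safe w S m s ∧ o.NoOverflow w (x.eval m s) (y.eval m s)

/-- Code that leaves the value of an expression in register `t`, using registers from `t` on. -/
def Expr.code : Expr → ℕ → List Instr
  | .var r, t => [.op .or t r r]
  | .lit k, t => [.const t k]
  | .load e, t => e.code t ++ [.load t t]
  | .bin o x y, t => x.code t ++ (y.code (t + 1) ++ [.op o t t (t + 1)])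

/-- The number of instructions in the code of an expression. -/
def Expr.len : Expr → ℕ
  | .var _ => 1
  | .lit _ => 1
  | .load e => e.len + 1
  | .bin _ x y => x.len + y.len + 1

theorem Expr.length_code (e : Expr) (t : ℕ) : (e.code t).length = e.len := by
  induction e generalizing t with
  | var r => rfl
  | lit k => rfl
  | load e ih => simp [code, len, ih]
  | bin o x y ihx ihy => simp [code, len, ihx, ihy, add_assoc]

/-- The list `l` of instructions stands in the program `p` from position `pc` on. -/
def CodeAt (p : Program) (pc : ℕ) (l : List Instr) : Prop :=
  ∀ i < l.length, p[pc + i]? = l[i]?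

theorem codeAt_append {p : Program} {pc : ℕ} {l₁ l₂ : List Instr} :
    CodeAt p pc (l₁ ++ l₂) ↔ CodeAt p pc l₁ ∧ CodeAt p (pc + l₁.length) l₂ := by
  constructor
  · intro h
    refine ⟨fun i hi => ?_, fun i hi => ?_⟩
    · rw [h i (by simp; omega), List.getElem?_append_left hi]
    · have := h (l₁.length + i) (by simp; omega)
      rw [List.getElem?_append_right (by omega)] at this
      simpa [add_assoc] using this
  · rintro ⟨h₁, h₂⟩ i hi
    by_cases hl : i < l₁.length
    · rw [h₁ i hl, List.getElem?_append_left hl]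
    · have := h₂ (i - l₁.length) (by simp at hi; omega)
      rw [List.getElem?_append_right (by omega), ← this]
      congr 1
      omega

theorem codeAt_cons {p : Program} {pc : ℕ} {a : Instr} {l : List Instr} :
    CodeAt p pc (a :: l) ↔ p[pc]? = some a ∧ CodeAt p (pc + 1) l := by
  rw [← List.singleton_append, codeAt_append]
  simp [CodeAt]

theorem stepN_add {w S : ℕ} (p : Program) (t₁ t₂ : ℕ) (c : Config w S) :
    stepN p (t₁ + t₂) c = (stepN p t₁ c).bind (stepN p t₂) := by
  induction t₁ generalizing c with
  | zero => simp [stepN]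
  | succ t ih =>
    rw [show t + 1 + t₂ = (t + t₂) + 1 by omega]
    simp only [stepN, Option.bind_assoc]
    congr 1
    funext c'
    exact ih c'

/-- The configuration `c` can reach `c'` in at most `T` steps. -/
def Reaches {w S : ℕ} (p : Program) (c : Config w S) (T : ℕ) (c' : Config w S) : Prop :=
  ∃ t ≤ T, stepN p t c = some c'

theorem Reaches.refl {w S : ℕ} (p : Program) (c : Config w S) : Reaches p c 0 c :=
  ⟨0, le_rfl, rfl⟩

theorem Reaches.trans {w S : ℕ} {p : Program} {c₁ c₂ c₃ : Config w S} {T₁ T₂ : ℕ}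
    (h₁ : Reaches p c₁ T₁ c₂) (h₂ : Reaches p c₂ T₂ c₃) : Reaches p c₁ (T₁ + T₂) c₃ := by
  obtain ⟨t₁, ht₁, e₁⟩ := h₁
  obtain ⟨t₂, ht₂, e₂⟩ := h₂
  exact ⟨t₁ + t₂, by omega, by rw [stepN_add, e₁]; exact e₂⟩

theorem Reaches.mono {w S : ℕ} {p : Program} {c₁ c₂ : Config w S} {T₁ T₂ : ℕ}
    (h₁ : Reaches p c₁ T₁ c₂) (h : T₁ ≤ T₂) : Reaches p c₁ T₂ c₂ := by
  obtain ⟨t₁, ht₁, e₁⟩ := h₁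
  exact ⟨t₁, by omega, e₁⟩

theorem Reaches.single {w S : ℕ} {p : Program} {c₁ c₂ : Config w S}
    (h : step p c₁ = some c₂) : Reaches p c₁ 1 c₂ :=
  ⟨1, le_rfl, by simp [stepN, h]⟩

/-- The registers below `32` hold the values `s`. -/
def RegRep {w S : ℕ} (c : Config w S) (s : ℕ → ℕ) : Prop :=
  ∀ r < 32, (c.reg r).toNat = s r

/-- The memory holds the values `m`. -/
def MemRep {w S : ℕ} (c : Config w S) (m : ℕ → ℕ) : Prop :=
  ∀ i (h : i < S), (c.mem ⟨i, h⟩).toNat = m i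

/-- Registers from `t` on serve as an evaluation stack. Since `32 ≤ t`, the variables and the
intermediate results below `t` survive, which is what the induction needs for the second operand. -/
theorem Expr.reaches {w S : ℕ} {p : Program} {m s : ℕ → ℕ} (e : Expr) :
    ∀ (c : Config w S) (t : ℕ), 32 ≤ t → CodeAt p c.pc (e.code t) → MemRep c m → RegRep c s →
      e.Safe w S m s → ∃ c' : Config w S, Reaches p c e.len c' ∧ c'.pc = c.pc + e.len ∧
        c'.mem = c.mem ∧ (∀ r < t, c'.reg r = c.reg r) ∧ (c'.reg t).toNat = e.eval m s := by
  induction e with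
  | var r =>
    intro c t ht hc hm hs hr
    have h0 : p[c.pc]? = some (.op .or t r r) := (codeAt_cons.1 hc).1
    refine ⟨⟨c.pc + 1, Function.update c.reg t (c.reg r ||| c.reg r), c.mem⟩,
      Reaches.single ?_, rfl, rfl, ?_, ?_⟩
    · simp [step, h0, BinOp.eval]
    · intro r' hr'
      simp [Function.update_of_ne (ne_of_lt hr')]
    · simpa [eval] using hs r hr
  | lit k =>
    intro c t ht hc hm hs hr
    have h0 : p[c.pc]? = some (.const t k) := (codeAt_cons.1 hc).1
    refine ⟨⟨c.pc + 1, Function.update c.reg t (BitVec.ofNat w k), c.mem⟩,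
      Reaches.single ?_, rfl, rfl, ?_, ?_⟩
    · simp [step, h0]
    · intro r' hr'
      simp [Function.update_of_ne (ne_of_lt hr')]
    · simpa [eval] using Nat.mod_eq_of_lt hr
  | load e ih =>
    intro c t ht hc hm hs hr
    obtain ⟨hc₁, hc₂⟩ := codeAt_append.1 hc
    obtain ⟨c₁, h₁, hpc, hmem, hreg, hval⟩ := ih c t ht hc₁ hm hs hr.1
    have h0 : p[c₁.pc]? = some (.load t t) := by
      rw [hpc, ← e.length_code t]; exact (codeAt_cons.1 hc₂).1
    have hS : (c₁.reg t).toNat < S := by rw [hval]; exact hr.2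
    refine ⟨⟨c₁.pc + 1, Function.update c₁.reg t (c₁.mem ⟨_, hS⟩), c₁.mem⟩,
      h₁.trans (Reaches.single ?_), ?_, hmem, ?_, ?_⟩
    · simp [step, h0, hS]
    · simp [hpc, len, add_assoc]
    · intro r' hr'
      simp [Function.update_of_ne (ne_of_lt hr'), hreg r' hr']
    · simp only [Function.update_self, eval, hmem]
      rw [hm, hval]
  | bin o x y ihx ihy =>
    intro c t ht hc hm hs hr
    obtain ⟨hc₁, hc'⟩ := codeAt_append.1 hc
    obtain ⟨hc₂, hc₃⟩ := codeAt_append.1 hc'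
    obtain ⟨c₁, h₁, hpc, hmem, hreg, hval⟩ := ihx c t ht hc₁ hm hs hr.1
    rw [x.length_code, ← hpc] at hc₂ hc₃
    obtain ⟨c₂, h₂, hpc₂, hmem₂, hreg₂, hval₂⟩ := ihy c₁ (t + 1) (by omega) hc₂
      (by simpa [MemRep, hmem] using hm)
      (fun r hr => by rw [hreg r (by omega)]; exact hs r hr) hr.2.1
    rw [y.length_code, ← hpc₂] at hc₃
    have h0 : p[c₂.pc]? = some (.op o t t (t + 1)) := (codeAt_cons.1 hc₃).1
    have hvx : (c₂.reg t).toNat = x.eval m s := by rw [hreg₂ t (by omega), hval]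
    refine ⟨⟨c₂.pc + 1, Function.update c₂.reg t (o.eval (c₂.reg t) (c₂.reg (t + 1))), c₂.mem⟩,
      (h₁.trans h₂).trans (Reaches.single ?_), ?_, by simp [hmem, hmem₂], ?_, ?_⟩
    · simp [step, h0]
    · simp [hpc, hpc₂, len, add_assoc]
    · intro r' hr'
      simp [Function.update_of_ne (ne_of_lt hr'), hreg₂ r' (by omega), hreg r' hr']
    · simp only [Function.update_self, eval]
      rw [BinOp.toNat_eval, hvx, hval₂]
      rw [hvx, hval₂]
      exact hr.2.2

/-! ### Structured programs and their execution rules -/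

/-- Structured programs; the conditions compare two expressions. -/
inductive Cmd
  | skip
  | assign (x : ℕ) (e : Expr)
  | seq (c₁ c₂ : Cmd)
  | ifLt (x y : Expr) (c₁ c₂ : Cmd)
  | whileLt (x y : Expr) (c : Cmd)

/-- The number of instructions in the code of a structured program. -/
def Cmd.len : Cmd → ℕ
  | .skip => 0
  | .assign _ e => e.len + 1
  | .seq c₁ c₂ => c₁.len + c₂.len
  | .ifLt x y c₁ c₂ => x.len + y.len + 2 + c₁.len + c₂.len
  | .whileLt x y c => x.len + y.len + 3 + c.len

/-- The code of a structured program, to be placed at position `pc`. -/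
def Cmd.code : Cmd → ℕ → List Instr
  | .skip, _ => []
  | .assign x e, _ => e.code 32 ++ [.op .or x 32 32]
  | .seq c₁ c₂, pc => c₁.code pc ++ c₂.code (pc + c₁.len)
  | .ifLt x y c₁ c₂, pc =>
      -- The second branch comes first, because a failed comparison falls through. `jumpEq 0 0`
      -- compares a register with itself and is an unconditional jump.
      x.code 32 ++ (y.code 33 ++ ([.jumpLt 32 33 (pc + x.len + y.len + 2 + c₂.len)] ++
        (c₂.code (pc + x.len + y.len + 1) ++
        ([.jumpEq 0 0 (pc + x.len + y.len + 2 + c₂.len + c₁.len)] ++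
        c₁.code (pc + x.len + y.len + 2 + c₂.len)))))
  | .whileLt x y c, pc =>
      x.code 32 ++ (y.code 33 ++ ([.jumpLt 32 33 (pc + x.len + y.len + 2)] ++
        ([.jumpEq 0 0 (pc + x.len + y.len + 3 + c.len)] ++
        (c.code (pc + x.len + y.len + 2) ++ [.jumpEq 0 0 pc]))))

theorem Cmd.length_code (c : Cmd) (pc : ℕ) : (c.code pc).length = c.len := by
  induction c generalizing pc with
  | skip => rfl
  | assign x e => simp [code, len, Expr.length_code]
  | seq c₁ c₂ ih₁ ih₂ => simp [code, len, ih₁, ih₂]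
  | ifLt x y c₁ c₂ ih₁ ih₂ => simp [code, len, ih₁, ih₂, Expr.length_code]; omega
  | whileLt x y c ih => simp [code, len, ih, Expr.length_code]; omega

/-- Started with memory `m` and variables `s`, the program `c` ends within `T` steps with
variables `s'`, and never writes to the memory. -/
def Exec (w S : ℕ) (m : ℕ → ℕ) (c : Cmd) (s : ℕ → ℕ) (T : ℕ) (s' : ℕ → ℕ) : Prop :=
  ∀ (p : Program) (cfg : Config w S), CodeAt p cfg.pc (c.code cfg.pc) → MemRep cfg m →
    RegRep cfg s → ∃ cfg' : Config w S, Reaches p cfg T cfg' ∧ cfg'.pc = cfg.pc + c.len ∧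
      cfg'.mem = cfg.mem ∧ RegRep cfg' s'

section Rules

variable {w S : ℕ} {m : ℕ → ℕ}

theorem Exec.skip (s : ℕ → ℕ) : Exec w S m .skip s 0 s :=
  fun p cfg _ _ hs => ⟨cfg, Reaches.refl p cfg, rfl, rfl, hs⟩

theorem Exec.mono {c : Cmd} {s s' : ℕ → ℕ} {T T' : ℕ} (h : Exec w S m c s T s') (hT : T ≤ T') :
    Exec w S m c s T' s' := by
  intro p cfg hc hm hs
  obtain ⟨c', h₁, h₂⟩ := h p cfg hc hm hs
  exact ⟨c', h₁.mono hT, h₂⟩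

theorem Exec.assign {x : ℕ} {e : Expr} {s : ℕ → ℕ} (he : e.Safe w S m s) :
    Exec w S m (.assign x e) s (e.len + 1) (Function.update s x (e.eval m s)) := by
  intro p cfg hc hm hs
  obtain ⟨hc₁, hc₂⟩ := codeAt_append.1 hc
  obtain ⟨c₁, h₁, hpc, hmem, hreg, hval⟩ := e.reaches cfg 32 le_rfl hc₁ hm hs he
  have h0 : p[c₁.pc]? = some (.op .or x 32 32) := by
    rw [hpc, ← e.length_code 32]; exact (codeAt_cons.1 hc₂).1
  refine ⟨⟨c₁.pc + 1, Function.update c₁.reg x (c₁.reg 32 ||| c₁.reg 32), c₁.mem⟩,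
    h₁.trans (Reaches.single ?_), ?_, hmem, ?_⟩
  · simp [step, h0, BinOp.eval]
  · simp [hpc, Cmd.len, add_assoc]
  · intro r hr
    by_cases hx : r = x
    · subst hx
      simpa using hval
    · simp [Function.update_of_ne hx, hreg r hr, hs r hr]

theorem Exec.seq {c₁ c₂ : Cmd} {s s₁ s₂ : ℕ → ℕ} {T₁ T₂ : ℕ} (h₁ : Exec w S m c₁ s T₁ s₁)
    (h₂ : Exec w S m c₂ s₁ T₂ s₂) : Exec w S m (.seq c₁ c₂) s (T₁ + T₂) s₂ := by
  intro p cfg hc hm hs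
  obtain ⟨hc₁, hc₂⟩ := codeAt_append.1 hc
  obtain ⟨cfg₁, r₁, hpc₁, hmem₁, hs₁⟩ := h₁ p cfg hc₁ hm hs
  rw [c₁.length_code, ← hpc₁] at hc₂
  obtain ⟨cfg₂, r₂, hpc₂, hmem₂, hs₂⟩ := h₂ p cfg₁ hc₂ (by simpa [MemRep, hmem₁] using hm) hs₁
  exact ⟨cfg₂, r₁.trans r₂, by simp [hpc₂, hpc₁, Cmd.len, add_assoc], by rw [hmem₂, hmem₁], hs₂⟩

/-- The comparison that starts the code of conditionals and loops. -/
theorem exists_reaches_jumpLt {p : Program} {x y : Expr} {s : ℕ → ℕ} {cfg : Config w S}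
    {target : ℕ} {l : List Instr}
    (hc : CodeAt p cfg.pc (x.code 32 ++ (y.code 33 ++ ([.jumpLt 32 33 target] ++ l))))
    (hm : MemRep cfg m) (hs : RegRep cfg s) (hx : x.Safe w S m s) (hy : y.Safe w S m s) :
    CodeAt p (cfg.pc + x.len + y.len + 1) l ∧
    ∃ cfg' : Config w S, Reaches p cfg (x.len + y.len + 1) cfg' ∧
      cfg'.pc = (if x.eval m s < y.eval m s then target else cfg.pc + x.len + y.len + 1) ∧
      cfg'.mem = cfg.mem ∧ RegRep cfg' s := by
  obtain ⟨hc₁, hc'⟩ := codeAt_append.1 hc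
  obtain ⟨hc₂, hc₃⟩ := codeAt_append.1 hc'
  obtain ⟨c₁, h₁, hpc, hmem, hreg, hval⟩ := x.reaches cfg 32 le_rfl hc₁ hm hs hx
  rw [x.length_code, ← hpc] at hc₂ hc₃
  have hs₁ : RegRep c₁ s := fun r hr => by rw [hreg r hr]; exact hs r hr
  obtain ⟨c₂, h₂, hpc₂, hmem₂, hreg₂, hval₂⟩ := y.reaches c₁ 33 (by omega) hc₂
    (by simpa [MemRep, hmem] using hm) hs₁ hy
  rw [y.length_code, ← hpc₂] at hc₃
  obtain ⟨h0, hl⟩ := codeAt_cons.1 hc₃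
  have hvx : (c₂.reg 32).toNat = x.eval m s := by rw [hreg₂ 32 (by omega), hval]
  refine ⟨by simpa [hpc₂, hpc] using hl,
    ⟨if c₂.reg 32 < c₂.reg 33 then target else c₂.pc + 1, c₂.reg, c₂.mem⟩,
    (h₁.trans h₂).trans (Reaches.single ?_), ?_, by simp [hmem, hmem₂], ?_⟩
  · simp [step, h0]
  · simp [BitVec.lt_def, hvx, hval₂, hpc₂, hpc]
  · intro r hr
    rw [← hs₁ r hr, ← hreg₂ r (by omega)]

theorem reaches_jump {p : Program} {cfg : Config w S} {target : ℕ}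
    (h : p[cfg.pc]? = some (.jumpEq 0 0 target)) :
    Reaches p cfg 1 ⟨target, cfg.reg, cfg.mem⟩ :=
  Reaches.single (by simp [step, h])

theorem Exec.ifLt_true {x y : Expr} {c₁ c₂ : Cmd} {s s' : ℕ → ℕ} {T : ℕ}
    (hx : x.Safe w S m s) (hy : y.Safe w S m s) (hlt : x.eval m s < y.eval m s)
    (h : Exec w S m c₁ s T s') :
    Exec w S m (.ifLt x y c₁ c₂) s (x.len + y.len + 2 + T) s' := by
  intro p cfg hc hm hs
  obtain ⟨hl, c', h₁, hpc, hmem, hs'⟩ := exists_reaches_jumpLt hc hm hs hx hy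
  rw [if_pos hlt] at hpc
  have hl₂ := (codeAt_append.1 hl).2
  have hl₃ := (codeAt_append.1 hl₂).2
  simp only [List.length_singleton, Cmd.length_code] at hl₃
  have : cfg.pc + x.len + y.len + 1 + c₂.len + 1 = c'.pc := by omega
  rw [this, ← hpc] at hl₃
  obtain ⟨c₃, h₃, hpc₃, hmem₃, hs₃⟩ := h p c' hl₃ (by simpa [MemRep, hmem] using hm) hs'
  refine ⟨c₃, (h₁.trans h₃).mono (by omega), ?_, by rw [hmem₃, hmem], hs₃⟩
  rw [hpc₃, hpc]
  simp only [Cmd.len]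
  omega

theorem Exec.ifLt_false {x y : Expr} {c₁ c₂ : Cmd} {s s' : ℕ → ℕ} {T : ℕ}
    (hx : x.Safe w S m s) (hy : y.Safe w S m s) (hlt : ¬ x.eval m s < y.eval m s)
    (h : Exec w S m c₂ s T s') :
    Exec w S m (.ifLt x y c₁ c₂) s (x.len + y.len + 2 + T) s' := by
  intro p cfg hc hm hs
  obtain ⟨hl, c', h₁, hpc, hmem, hs'⟩ := exists_reaches_jumpLt hc hm hs hx hy
  rw [if_neg hlt] at hpc
  obtain ⟨hl₁, hl₂⟩ := codeAt_append.1 hl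
  rw [← hpc] at hl₁ hl₂
  obtain ⟨c₃, h₃, hpc₃, hmem₃, hs₃⟩ := h p c' hl₁ (by simpa [MemRep, hmem] using hm) hs'
  rw [Cmd.length_code, ← hpc₃] at hl₂
  refine ⟨_, (h₁.trans (h₃.trans (reaches_jump (codeAt_cons.1 hl₂).1))).mono (by omega), ?_,
    by simp [hmem₃, hmem], hs₃⟩
  simp only [Cmd.len]
  omega

theorem Exec.while_false {x y : Expr} {c : Cmd} {s : ℕ → ℕ}
    (hx : x.Safe w S m s) (hy : y.Safe w S m s) (hlt : ¬ x.eval m s < y.eval m s) :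
    Exec w S m (.whileLt x y c) s (x.len + y.len + 2) s := by
  intro p cfg hc hm hs
  obtain ⟨hl, c', h₁, hpc, hmem, hs'⟩ := exists_reaches_jumpLt hc hm hs hx hy
  rw [if_neg hlt] at hpc
  rw [← hpc] at hl
  refine ⟨_, h₁.trans (reaches_jump (codeAt_cons.1 hl).1), ?_, hmem, hs'⟩
  simp only [Cmd.len]
  omega

theorem Exec.while_true {x y : Expr} {c : Cmd} {s s₁ s₂ : ℕ → ℕ} {T₁ T₂ : ℕ}
    (hx : x.Safe w S m s) (hy : y.Safe w S m s) (hlt : x.eval m s < y.eval m s)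
    (h₁ : Exec w S m c s T₁ s₁) (h₂ : Exec w S m (.whileLt x y c) s₁ T₂ s₂) :
    Exec w S m (.whileLt x y c) s (x.len + y.len + 2 + T₁ + T₂) s₂ := by
  intro p cfg hc hm hs
  obtain ⟨hl, c', r₁, hpc, hmem, hs'⟩ := exists_reaches_jumpLt hc hm hs hx hy
  rw [if_pos hlt] at hpc
  obtain ⟨_, hl₂⟩ := codeAt_append.1 hl
  obtain ⟨hl₃, hl₄⟩ := codeAt_append.1 hl₂
  simp only [List.length_singleton, Cmd.length_code] at hl₃ hl₄
  rw [show cfg.pc + x.len + y.len + 1 + 1 = cfg.pc + x.len + y.len + 2 by omega, ← hpc]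
    at hl₃ hl₄
  have hm' : MemRep c' m := by simpa [MemRep, hmem] using hm
  obtain ⟨c₃, h₃, hpc₃, hmem₃, hs₃⟩ := h₁ p c' hl₃ hm' hs'
  rw [← hpc₃] at hl₄
  have r₄ := reaches_jump (codeAt_cons.1 hl₄).1
  obtain ⟨c₅, h₅, hpc₅, hmem₅, hs₅⟩ := h₂ p ⟨cfg.pc, c₃.reg, c₃.mem⟩ hc
    (by simpa [MemRep, hmem₃] using hm') hs₃
  exact ⟨c₅, (r₁.trans (h₃.trans (r₄.trans h₅))).mono (by omega), hpc₅,
    by rw [hmem₅]; simp [hmem₃, hmem], hs₅⟩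

end Rules

/-! ### Binary search -/

/-- Binary search: register `8` holds a place where `x < y` is true, register `9` one where it is
false; the place in question is in register `10`. -/
def bsearch (x y : Expr) : Cmd :=
  .whileLt (.bin .add (.var 8) (.lit 1)) (.var 9)
    (.seq (.assign 10 (.bin .shr (.bin .add (.var 8) (.var 9)) (.lit 1)))
      (.ifLt x y (.assign 8 (.var 10)) (.assign 9 (.var 10))))

/-- The invariant is `Q` at the lower end and `¬ Q` at the upper end; each of at most `k` rounds
halves the distance. `Q` need not be monotone: the search ends at some place where it changes from
true to false. The test must be correct only strictly between the ends, for all states that agree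
outside the three search registers. -/
theorem exec_bsearch {w S : ℕ} {m : ℕ → ℕ} {x y : Expr} {Q : ℕ → Prop} (k : ℕ) :
    ∀ {s : ℕ → ℕ}, s 8 < s 9 → 2 * s 9 < 2 ^ w → Q (s 8) → ¬ Q (s 9) → s 9 - s 8 ≤ 2 ^ k →
      (∀ i, s 8 < i → i < s 9 → ∀ s' : ℕ → ℕ, (∀ r, r ≠ 8 → r ≠ 9 → r ≠ 10 → s' r = s r) →
        s' 10 = i → x.Safe w S m s' ∧ y.Safe w S m s' ∧ (x.eval m s' < y.eval m s' ↔ Q i)) →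
      ∃ s', Exec w S m (bsearch x y) s ((x.len + y.len + 16) * (k + 1)) s' ∧
        s 8 ≤ s' 8 ∧ s' 8 < s 9 ∧ Q (s' 8) ∧ ¬ Q (s' 8 + 1) ∧
        ∀ r, r ≠ 8 → r ≠ 9 → r ≠ 10 → s' r = s r := by
  induction k with
  | zero =>
    intro s hlt hw hlo hhi hk _
    have h9 : s 9 = s 8 + 1 := by simp at hk; omega
    refine ⟨s, (Exec.while_false ?_ ?_ ?_).mono ?_, le_rfl, hlt, hlo, h9 ▸ hhi, fun _ _ _ _ => rfl⟩
    · simp only [Expr.Safe, BinOp.NoOverflow, Expr.eval]; omega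
    · simp [Expr.Safe]
    · simp [Expr.eval, BinOp.natEval]; omega
    · simp only [Expr.len]; omega
  | succ k ih =>
    intro s hlt hw hlo hhi hk h
    have hs₁ : (Expr.bin .add (.var 8) (.lit 1)).Safe w S m s := by
      simp only [Expr.Safe, BinOp.NoOverflow, Expr.eval]; omega
    by_cases h9 : s 9 = s 8 + 1
    · refine ⟨s, (Exec.while_false hs₁ ?_ ?_).mono ?_, le_rfl, hlt, hlo, h9 ▸ hhi,
        fun _ _ _ _ => rfl⟩
      · simp [Expr.Safe]
      · simp [Expr.eval, BinOp.natEval]; omega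
      · simp only [Expr.len]; nlinarith
    · have hmid := Exec.assign (w := w) (S := S) (m := m) (x := 10) (s := s)
        (e := .bin .shr (.bin .add (.var 8) (.var 9)) (.lit 1))
        (by simp only [Expr.Safe, BinOp.NoOverflow, Expr.eval, and_true]; omega)
      have hval : (Expr.bin .shr (.bin .add (.var 8) (.var 9)) (.lit 1)).eval m s
          = (s 8 + s 9) / 2 := by simp [Expr.eval, BinOp.natEval]
      rw [hval] at hmid
      set i := (s 8 + s 9) / 2 with hi
      obtain ⟨hsx, hsy, hQ⟩ := h i (by omega) (by omega) (Function.update s 10 i)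
        (fun r _ _ hr => by simp [hr]) (by simp)
      have hpow : 2 ^ (k + 1) = 2 * 2 ^ k := by ring
      have hguard : (Expr.bin .add (.var 8) (.lit 1)).eval m s < (Expr.var 9).eval m s := by
        simp [Expr.eval, BinOp.natEval]; omega
      by_cases hq : Q i
      · have h2 := Exec.ifLt_true (c₂ := .assign 9 (.var 10)) hsx hsy (hQ.2 hq)
          (Exec.assign (x := 8) (e := .var 10) (by simp [Expr.Safe]))
        obtain ⟨s', hex, hle, hlt', hq', hnq', hrest⟩ := ih
          (s := Function.update (Function.update s 10 i) 8 i)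
          (by simp; omega) (by simpa using hw) (by simpa using hq) (by simpa using hhi)
          (by simp; omega)
          (fun j hj₁ hj₂ s' hs' hj => by
            refine h j ?_ ?_ s' (fun r h8 h9 h10 => ?_) hj
            · simp at hj₁; omega
            · simpa using hj₂
            · rw [hs' r h8 h9 h10]; simp [h8, h10])
        simp only [Expr.eval, Function.update_self] at h2
        refine ⟨s', (Exec.while_true hs₁ (by simp [Expr.Safe]) hguard (hmid.seq h2) hex).mono ?_,
          ?_, ?_, hq', hnq', fun r h8 h9 h10 => ?_⟩
        · simp only [Expr.len]; nlinarith
        · simp at hle; omega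
        · simpa using hlt'
        · rw [hrest r h8 h9 h10]; simp [h8, h10]
      · have h2 := Exec.ifLt_false (c₁ := .assign 8 (.var 10)) hsx hsy (fun hh => hq (hQ.1 hh))
          (Exec.assign (x := 9) (e := .var 10) (by simp [Expr.Safe]))
        obtain ⟨s', hex, hle, hlt', hq', hnq', hrest⟩ := ih
          (s := Function.update (Function.update s 10 i) 9 i)
          (by simp; omega) (by simp; omega) (by simpa using hlo) (by simpa using hq)
          (by simp; omega)
          (fun j hj₁ hj₂ s' hs' hj => by
            refine h j ?_ ?_ s' (fun r h8 h9 h10 => ?_) hj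
            · simpa using hj₁
            · simp at hj₂; omega
            · rw [hs' r h8 h9 h10]; simp [h9, h10])
        simp only [Expr.eval, Function.update_self] at h2
        refine ⟨s', (Exec.while_true hs₁ (by simp [Expr.Safe]) hguard (hmid.seq h2) hex).mono ?_,
          ?_, ?_, hq', hnq', fun r h8 h9 h10 => ?_⟩
        · simp only [Expr.len]; nlinarith
        · simpa using hle
        · simp at hlt'; omega
        · rw [hrest r h8 h9 h10]; simp [h9, h10]

/-- The values of the variables at the start of a query. -/
def startVars (a b c d : ℕ) : ℕ → ℕ
  | 0 => a
  | 1 => b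
  | 2 => c
  | 3 => d
  | _ => 0

/-- Passes from executions over natural numbers to the machine model; `Exec` already contains that
the memory is unchanged. -/
theorem answers_of_exec {w S : ℕ} {m : ℕ → ℕ} {cmd : Cmd} {a b c d T : ℕ} {s' : ℕ → ℕ}
    (ha : a < 2 ^ w) (hb : b < 2 ^ w) (hc : c < 2 ^ w) (hd : d < 2 ^ w)
    (hm : ∀ i < S, m i < 2 ^ w) (h : Exec w S m cmd (startVars a b c d) T s') :
    Answers (cmd.code 0 ++ [.halt]) (fun i : Fin S => BitVec.ofNat w (m i)) a b c d T (s' 0) := by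
  have hcode : CodeAt (cmd.code 0 ++ [.halt]) 0 (cmd.code 0 ++ [.halt]) := by
    intro i _; simp
  obtain ⟨h₁, h₂⟩ := codeAt_append.1 hcode
  obtain ⟨cfg, ⟨t, ht, hstep⟩, hpc, hmem, hreg⟩ := h _
    (queryStart (fun i : Fin S => BitVec.ofNat w (m i)) a b c d) h₁
    (fun i hi => by simpa [queryStart] using Nat.mod_eq_of_lt (hm i hi))
    (fun r _ => by
      rcases r with _ | _ | _ | _ | r <;> simp [queryStart, startVars, Nat.mod_eq_of_lt, *])
  refine ⟨t, cfg, by exact_mod_cast ht, hstep, ?_, hmem, hreg 0 (by norm_num)⟩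
  rw [Cmd.length_code] at h₂
  rw [hpc]
  exact (codeAt_cons.1 h₂).1

end WordRAM

open Finset

/-! ### Perfect hashing by displacement -/

/-- Rows of sets of columns can be shifted so that no two of their elements collide. -/
theorem exists_row_displacement (I : Finset ℕ) (C : ℕ → Finset ℕ) :
    ∃ r : ℕ → ℕ, (∀ i, r i ≤ ∑ i ∈ I, #(C i) ^ 2) ∧
      ∀ i ∈ I, ∀ j ∈ C i, ∀ i' ∈ I, ∀ j' ∈ C i', r i + j = r i' + j' → i = i' := by
  -- The range of displacements is fixed at its final size `E` before rows are inserted one by one.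
  suffices H : ∀ E, ∑ i ∈ I, #(C i) ^ 2 ≤ E → ∃ r : ℕ → ℕ, (∀ i, r i ≤ E) ∧
      ∀ i ∈ I, ∀ j ∈ C i, ∀ i' ∈ I, ∀ j' ∈ C i', r i + j = r i' + j' → i = i' from H _ le_rfl
  intro E
  induction I using Finset.induction_on_min_value (fun i => #(C i)) with
  | empty => exact fun _ => ⟨fun _ => 0, fun _ => Nat.zero_le _, by simp⟩
  -- First fit in order of decreasing size: the new row is no larger than the earlier ones. Each
  -- earlier row `i` forbids at most `#(C i) * #(C a) ≤ #(C i) ^ 2` displacements, so one of the `E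
  -- + 1` candidates stays free.
  | insert a s ha hmin ih =>
    intro hE
    rw [sum_insert ha] at hE
    obtain ⟨r, hr, hinj⟩ := ih (by omega)
    let bad : Finset ℕ := s.biUnion fun i =>
      (C i ×ˢ C a).image fun q => r i + q.1 - q.2
    have hbad : #bad < #(range (E + 1)) := by
      rw [card_range, Nat.lt_succ_iff]
      refine le_trans card_biUnion_le (le_trans (sum_le_sum fun i hi => ?_)
        (le_trans (Nat.le_add_left _ (#(C a) ^ 2)) hE))
      refine card_image_le.trans ?_
      rw [card_product, sq]
      exact Nat.mul_le_mul_left _ (hmin i hi)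
    obtain ⟨t, ht, htb⟩ := exists_mem_notMem_of_card_lt_card hbad
    have key : ∀ i ∈ s, ∀ j ∈ C i, ∀ j' ∈ C a, r i + j ≠ t + j' := by
      intro i hi j hj j' hj' he
      refine htb (mem_biUnion.2 ⟨i, hi, mem_image.2 ⟨(j, j'), mem_product.2 ⟨hj, hj'⟩, ?_⟩⟩)
      simp only
      omega
    refine ⟨Function.update r a t, fun i => ?_, ?_⟩
    · by_cases hi : i = a
      · subst hi; simp at ht ⊢; omega
      · simpa [hi] using hr i
    · intro i hi j hj i' hi' j' hj' he
      by_contra hne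
      rcases mem_insert.1 hi with rfl | hs
      · rcases mem_insert.1 hi' with rfl | hs'
        · exact hne rfl
        · rw [Function.update_self, Function.update_of_ne (Ne.symm hne)] at he
          exact key i' hs' j' hj' j hj he.symm
      · rcases mem_insert.1 hi' with rfl | hs'
        · rw [Function.update_self, Function.update_of_ne hne] at he
          exact key i hs j hj j' hj' he
        · rw [Function.update_of_ne (fun h : i = a => ha (h ▸ hs)),
            Function.update_of_ne (fun h : i' = a => ha (h ▸ hs'))] at he
          exact hne (hinj i hs j hj i' hs' j' hj' he)

/-- The pairs of elements of `K` that fall into the same row after column displacement. -/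
def rowCollisions (c : ℕ → ℕ) (K : Finset (ℕ × ℕ)) : Finset ((ℕ × ℕ) × (ℕ × ℕ)) :=
  (K ×ˢ K).filter fun q => q.1.1 + c q.1.2 = q.2.1 + c q.2.2

/-- Columns can be displaced so that few pairs of elements fall into the same row. -/
theorem exists_column_displacement {R : ℕ} (hR : 0 < R) (K : Finset (ℕ × ℕ)) (V : ℕ) :
    ∃ c : ℕ → ℕ, (∀ v, c v < R) ∧ R * #(rowCollisions c (K.filter (·.2 < V))) ≤
      R * #(K.filter (·.2 < V)) + #(K.filter (·.2 < V)) ^ 2 := by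
  induction V with
  | zero => exact ⟨fun _ => 0, fun _ => hR, by simp [rowCollisions]⟩
  | succ V ih =>
    obtain ⟨c, hc, hcard⟩ := ih
    set A := K.filter (·.2 < V) with hA
    set B := K.filter (·.2 = V) with hB
    have hAB : K.filter (·.2 < V + 1) = A ∪ B := by
      ext k
      simp only [hA, hB, mem_filter, mem_union, ← and_or_left]
      refine and_congr_right fun _ => ?_
      omega
    have hdisj : Disjoint A B := by
      rw [Finset.disjoint_left]
      intro k h₁ h₂
      have := (mem_filter.1 h₁).2
      have := (mem_filter.1 h₂).2
      omega
    let X : ℕ → Finset ((ℕ × ℕ) × (ℕ × ℕ)) := fun x =>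
      (A ×ˢ B).filter fun q => q.1.1 + c q.1.2 = q.2.1 + x
    -- An old and a new element collide for at most one displacement `x` of the new column, so the
    -- best `x` does at least as well as the average over `R` displacements.
    have hsum : ∑ x ∈ range R, #(X x) ≤ #A * #B := by
      rw [← card_product, ← card_biUnion]
      · exact card_le_card (biUnion_subset.2 fun x _ => filter_subset _ _)
      · intro x _ y _ hxy
        rw [Function.onFun, Finset.disjoint_left]
        intro q h₁ h₂
        have := (mem_filter.1 h₁).2
        have := (mem_filter.1 h₂).2
        omega
    obtain ⟨x, hx, hmin⟩ := exists_min_image (range R) (fun x => #(X x)) ⟨0, mem_range.2 hR⟩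
    have hXx : R * #(X x) ≤ #A * #B := by
      refine le_trans ?_ hsum
      simpa using card_nsmul_le_sum (range R) (fun x => #(X x)) _ hmin
    have hxR := mem_range.1 hx
    refine ⟨Function.update c V x, fun v => ?_, ?_⟩
    · by_cases hv : v = V
      · subst hv; simpa using hxR
      · simpa [hv] using hc v
    -- Elements of the new column share their displacement, so among themselves they only form
    -- diagonal pairs; mixed collisions occur in both orders.
    have hsub : rowCollisions (Function.update c V x) (A ∪ B) ⊆
        (rowCollisions c A ∪ B.image (fun k => (k, k))) ∪
          (X x ∪ (X x).image Prod.swap) := by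
      intro q hq
      obtain ⟨hq₁, hq₂⟩ := mem_filter.1 hq
      obtain ⟨h₁, h₂⟩ := mem_product.1 hq₁
      have colA : ∀ k ∈ A, Function.update c V x k.2 = c k.2 := fun k hk => by
        rw [Function.update_of_ne (ne_of_lt (mem_filter.1 hk).2)]
      have colB : ∀ k ∈ B, Function.update c V x k.2 = x := fun k hk => by
        rw [(mem_filter.1 hk).2, Function.update_self]
      rw [mem_union, mem_union, mem_union]
      rcases mem_union.1 h₁ with h₁ | h₁ <;> rcases mem_union.1 h₂ with h₂ | h₂
      · rw [colA _ h₁, colA _ h₂] at hq₂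
        exact .inl (.inl (mem_filter.2 ⟨mem_product.2 ⟨h₁, h₂⟩, hq₂⟩))
      · rw [colA _ h₁, colB _ h₂] at hq₂
        exact .inr (.inl (mem_filter.2 ⟨mem_product.2 ⟨h₁, h₂⟩, hq₂⟩))
      · rw [colB _ h₁, colA _ h₂] at hq₂
        exact .inr (.inr (mem_image.2 ⟨q.swap,
          mem_filter.2 ⟨mem_product.2 ⟨h₂, h₁⟩, hq₂.symm⟩, Prod.swap_swap q⟩))
      · rw [colB _ h₁, colB _ h₂] at hq₂
        refine .inl (.inr (mem_image.2 ⟨q.1, h₁, Prod.ext rfl (Prod.ext (by simpa using hq₂) ?_)⟩))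
        rw [(mem_filter.1 h₁).2, (mem_filter.1 h₂).2]
    have hle : #(rowCollisions (Function.update c V x) (A ∪ B)) ≤
        #(rowCollisions c A) + #B + (#(X x) + #(X x)) :=
      (card_le_card hsub).trans ((card_union_le _ _).trans (add_le_add
        ((card_union_le _ _).trans (add_le_add_right card_image_le _))
        ((card_union_le _ _).trans (add_le_add_right card_image_le _))))
    rw [hAB, card_union_of_disjoint hdisj]
    have := Nat.mul_le_mul_left R hle
    nlinarith

/-- Perfect hashing of pairs by column displacement followed by row displacement. -/
theorem exists_perfect_hash {R : ℕ} (hR : 0 < R) (K : Finset (ℕ × ℕ)) (hK : #K ≤ R) :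
    ∃ c r : ℕ → ℕ, (∀ v, c v < R) ∧ (∀ i, r i ≤ 2 * R) ∧
      Set.InjOn (fun k : ℕ × ℕ => r (k.1 + c k.2) + k.2) K := by
  obtain ⟨V, hV⟩ : ∃ V, ∀ k ∈ K, k.2 < V :=
    ⟨K.sup (·.2) + 1, fun k hk => Nat.lt_succ_of_le (le_sup (f := fun k : ℕ × ℕ => k.2) hk)⟩
  obtain ⟨c, hc, hcol⟩ := exists_column_displacement hR K V
  rw [filter_true_of_mem hV] at hcol
  let row : ℕ × ℕ → ℕ := fun k => k.1 + c k.2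
  let C : ℕ → Finset ℕ := fun i => (K.filter fun k => row k = i).image (·.2)
  obtain ⟨r, hr, hinj⟩ := exists_row_displacement (K.image row) C
  -- Grouping colliding pairs by their common row counts the square of every row size, so few
  -- collisions mean small row displacements.
  have hsq : ∑ i ∈ K.image row, #(C i) ^ 2 ≤ #(rowCollisions c K) := by
    have : ∀ i ∈ K.image row, #(C i) ^ 2 ≤
        #((rowCollisions c K).filter fun q => row q.1 = i) := by
      intro i _
      refine (Nat.pow_le_pow_left card_image_le 2).trans ?_
      rw [sq, ← card_product]
      refine card_le_card fun q hq => ?_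
      simp only [mem_product, mem_filter, rowCollisions] at hq ⊢
      exact ⟨⟨⟨hq.1.1, hq.2.1⟩, hq.1.2.trans hq.2.2.symm⟩, hq.1.2⟩
    refine (sum_le_sum this).trans (le_of_eq (card_eq_sum_card_fiberwise fun q hq => ?_).symm)
    exact mem_image_of_mem row (mem_product.1 (mem_filter.1 hq).1).1
  have hcol' : #(rowCollisions c K) ≤ 2 * R := by
    refine Nat.le_of_mul_le_mul_left ?_ hR
    nlinarith
  refine ⟨c, r, hc, fun i => (hr i).trans (hsq.trans hcol'), ?_⟩
  intro k hk k' hk' he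
  have h₁ : row k = row k' := hinj _ (mem_image_of_mem row hk) k.2
    (mem_image.2 ⟨k, mem_filter.2 ⟨hk, rfl⟩, rfl⟩) _ (mem_image_of_mem row hk') k'.2
    (mem_image.2 ⟨k', mem_filter.2 ⟨hk', rfl⟩, rfl⟩) he
  have h₂ : k.2 = k'.2 := by
    simp only at he
    simp only [row] at h₁
    rw [h₁] at he
    omega
  refine Prod.ext ?_ h₂
  simp only [row, h₂] at h₁
  omega

/-! ### Memory allocation -/

/-- Blocks of given sizes can be placed one after the other behind position `o`, and then be
filled with any contents. -/
theorem exists_allocation {ι : Type*} [DecidableEq ι] (I : Finset ι) (size : ι → ℕ) (o : ℕ) :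
    ∃ base : ι → ℕ, (∀ i ∈ I, o ≤ base i ∧ base i + size i ≤ o + ∑ i ∈ I, size i) ∧
      ∀ (m₀ : ℕ → ℕ) (f : ι → ℕ → ℕ), ∃ m : ℕ → ℕ, (∀ z < o, m z = m₀ z) ∧
        (∀ i ∈ I, ∀ z < size i, m (base i + z) = f i z) ∧
        ∀ B, (∀ z < o, m₀ z < B) → (∀ i ∈ I, ∀ z, f i z < B) →
          ∀ z < o + ∑ i ∈ I, size i, m z < B := by
  induction I using Finset.induction_on with
  | empty => exact ⟨fun _ => 0, by simp, fun m₀ _ => ⟨m₀, fun _ _ => rfl, by simp, fun _ h _ => by simpa using h⟩⟩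
  | insert a I ha ih =>
    obtain ⟨base, hbase, hfill⟩ := ih
    have hne : ∀ i ∈ I, i ≠ a := fun i hi h => ha (h ▸ hi)
    refine ⟨Function.update base a (o + ∑ i ∈ I, size i), ?_, ?_⟩
    · intro i hi
      rw [sum_insert ha]
      rcases mem_insert.1 hi with rfl | hi
      · simp; omega
      · have := hbase i hi
        simp [hne i hi]; omega
    · intro m₀ f
      obtain ⟨m, hm₀, hm, hB⟩ := hfill m₀ f
      refine ⟨fun z => if z < o + ∑ i ∈ I, size i then m z else
        f a (z - (o + ∑ i ∈ I, size i)), fun z hz => ?_, fun i hi z hz => ?_,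
        fun B h₁ h₂ z hz => ?_⟩
      · simp only; rw [if_pos (by omega), hm₀ z hz]
      · rcases mem_insert.1 hi with rfl | hi
        · simp
        · have := hbase i hi
          simp only [Function.update_of_ne (hne i hi)]
          rw [if_pos (by omega), hm i hi z hz]
      · simp only
        split_ifs with h
        · exact hB B h₁ (fun i hi => h₂ i (mem_insert_of_mem hi)) z h
        · exact h₂ a (mem_insert_self a I) _

/-! ### Cells of pairs of nodes, and ranks -/

/-- The height of a node of the complete binary tree whose leaves are `2 ^ H, …, 2 ^ (H + 1) - 1`
and in which `u / 2` is the parent of `u`. -/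
def nodeHeight (H u : ℕ) : ℕ := H - Nat.log 2 u

theorem nodeHeight_div {H A i : ℕ} (h₁ : 2 ^ H ≤ A) (h₂ : A < 2 ^ (H + 1)) (hi : i ≤ H) :
    nodeHeight H (A / 2 ^ i) = i := by
  have : Nat.log 2 A = H := Nat.log_eq_of_pow_le_of_lt_pow h₁ h₂
  rw [nodeHeight, Nat.log_div_base_pow, this]
  omega

/-- The points of `P` below the node `u` of the tree over the first coordinates and the node `v`
of the tree over the second coordinates. -/
def cell (L : ℕ) (P : Finset (ℕ × ℕ)) (u v : ℕ) : Finset (ℕ × ℕ) :=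
  P.filter fun p => p.1 / 2 ^ nodeHeight (L + 2) u = u ∧ p.2 / 2 ^ nodeHeight L v = v

/-- The pairs of nodes of height less than `L` with nonempty cells. -/
def cells (L : ℕ) (P : Finset (ℕ × ℕ)) : Finset (ℕ × ℕ) :=
  (P ×ˢ (range L ×ˢ range L)).image fun q => (q.1.1 / 2 ^ q.2.1, q.1.2 / 2 ^ q.2.2)

/-- The number of points below `v` with first coordinate less than `A`. -/
def rankBelow (L : ℕ) (P : Finset (ℕ × ℕ)) (v A : ℕ) : ℕ :=
  #(P.filter fun p => p.2 / 2 ^ nodeHeight L v = v ∧ p.1 < A)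

/-- The points are leaves of the two trees. -/
def AreLeaves (L : ℕ) (P : Finset (ℕ × ℕ)) : Prop :=
  ∀ p ∈ P, (2 ^ (L + 2) ≤ p.1 ∧ p.1 < 2 ^ (L + 3)) ∧ 2 ^ L ≤ p.2 ∧ p.2 < 2 ^ (L + 1)

section Cells

variable {L : ℕ} {P : Finset (ℕ × ℕ)}

theorem mem_cell {A C i j : ℕ} (hA₁ : 2 ^ (L + 2) ≤ A) (hA₂ : A < 2 ^ (L + 3))
    (hC₁ : 2 ^ L ≤ C) (hC₂ : C < 2 ^ (L + 1)) (hi : i ≤ L) (hj : j ≤ L) {p : ℕ × ℕ} :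
    p ∈ cell L P (A / 2 ^ i) (C / 2 ^ j) ↔
      p ∈ P ∧ p.1 / 2 ^ i = A / 2 ^ i ∧ p.2 / 2 ^ j = C / 2 ^ j := by
  rw [cell, mem_filter, nodeHeight_div hA₁ hA₂ (by omega), nodeHeight_div hC₁ hC₂ hj]

/-- A node number determines its height, since all leaves of a tree have the same binary length. So
a point that witnesses membership does so at the heights `i` and `j`. -/
theorem mem_cells {A C i j : ℕ} (hP : AreLeaves L P) (hA₁ : 2 ^ (L + 2) ≤ A)
    (hA₂ : A < 2 ^ (L + 3)) (hC₁ : 2 ^ L ≤ C) (hC₂ : C < 2 ^ (L + 1)) (hi : i < L) (hj : j < L) :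
    (A / 2 ^ i, C / 2 ^ j) ∈ cells L P ↔ (cell L P (A / 2 ^ i) (C / 2 ^ j)).Nonempty := by
  constructor
  · intro h
    obtain ⟨⟨p, i', j'⟩, hq, he⟩ := mem_image.1 h
    simp only [mem_product, mem_range, Prod.mk.injEq] at hq he
    obtain ⟨hx, hy⟩ := hP p hq.1
    have h₁ := nodeHeight_div hx.1 hx.2 (i := i') (by omega)
    have h₂ := nodeHeight_div hy.1 hy.2 (i := j') (by omega)
    rw [he.1, nodeHeight_div hA₁ hA₂ (by omega)] at h₁
    rw [he.2, nodeHeight_div hC₁ hC₂ (by omega)] at h₂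
    subst h₁ h₂
    exact ⟨p, (mem_cell hA₁ hA₂ hC₁ hC₂ hi.le hj.le).2 ⟨hq.1, he⟩⟩
  · rintro ⟨p, hp⟩
    obtain ⟨hp, hx, hy⟩ := (mem_cell hA₁ hA₂ hC₁ hC₂ hi.le hj.le).1 hp
    exact mem_image.2 ⟨(p, i, j), by simp [hp, hi, hj], by simp [hx, hy]⟩

/-- The nodes of a nonempty cell are ancestors of a point. -/
theorem exists_of_mem_cells (hP : AreLeaves L P) {k : ℕ × ℕ} (hk : k ∈ cells L P) :
    ∃ A C i j, (2 ^ (L + 2) ≤ A ∧ A < 2 ^ (L + 3)) ∧ (2 ^ L ≤ C ∧ C < 2 ^ (L + 1)) ∧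
      i < L ∧ j < L ∧ k = (A / 2 ^ i, C / 2 ^ j) := by
  obtain ⟨⟨p, i, j⟩, hq, he⟩ := mem_image.1 hk
  simp only [mem_product, mem_range] at hq
  exact ⟨p.1, p.2, i, j, (hP p hq.1).1, (hP p hq.1).2, hq.2.1, hq.2.2, he.symm⟩

theorem card_cells_le : #(cells L P) ≤ #P * L ^ 2 :=
  card_image_le.trans (by simp [sq])

/-- A point belongs to only one cell for each of the `L ^ 2` pairs of heights. This is the source of
the squared logarithm in the space. -/
theorem sum_card_cell_le (hP : AreLeaves L P) :
    ∑ k ∈ cells L P, #(cell L P k.1 k.2) ≤ #P * L ^ 2 := by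
  have h : #(P ×ˢ (range L ×ˢ range L)) = #P * L ^ 2 := by simp [sq]
  rw [← h, card_eq_sum_card_fiberwise (t := cells L P) fun q hq => mem_image_of_mem _ hq]
  refine sum_le_sum fun k hk => ?_
  obtain ⟨A, C, i, j, hA, hC, hi, hj, rfl⟩ := exists_of_mem_cells hP hk
  refine le_trans (card_le_card fun p hp => ?_) (card_image_le (f := Prod.fst))
  obtain ⟨hp, hx, hy⟩ := (mem_cell hA.1 hA.2 hC.1 hC.2 hi.le hj.le).1 hp
  refine mem_image.2 ⟨(p, i, j), ?_, rfl⟩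
  simp [hp, hi, hj, hx, hy]

/-- If the child of `A / 2 ^ (i + 1)` towards `A` has no points, the rank of `A` is the rank of an
end of the range of `A / 2 ^ (i + 1)`. -/
theorem rankBelow_eq_of_cell_empty {A C i j : ℕ} (hA₁ : 2 ^ (L + 2) ≤ A) (hA₂ : A < 2 ^ (L + 3))
    (hC₁ : 2 ^ L ≤ C) (hC₂ : C < 2 ^ (L + 1)) (hi : i ≤ L) (hj : j ≤ L)
    (h : ¬ (cell L P (A / 2 ^ i) (C / 2 ^ j)).Nonempty) :
    rankBelow L P (C / 2 ^ j) A =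
      rankBelow L P (C / 2 ^ j) ((A / 2 ^ (i + 1) + A / 2 ^ i % 2) * 2 ^ (i + 1)) := by
  unfold rankBelow
  congr 1
  refine filter_congr fun p hp => and_congr_right fun hy => ?_
  rw [nodeHeight_div hC₁ hC₂ hj] at hy
  have hne : p.1 / 2 ^ i ≠ A / 2 ^ i := fun hx =>
    h ⟨p, (mem_cell hA₁ hA₂ hC₁ hC₂ hi hj).2 ⟨hp, hx, hy⟩⟩
  have h₁ : p.1 < A ↔ p.1 / 2 ^ i < A / 2 ^ i := by
    constructor
    · intro hlt
      exact lt_of_le_of_ne (Nat.div_le_div_right hlt.le) hne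
    · exact fun hlt => lt_of_not_ge fun hge => hlt.not_ge (Nat.div_le_div_right hge)
  -- At height `i` no point below the second node shares the ancestor of `A`. If this is a left
  -- child, exactly the points before the parent's range precede `A`; if it is a right child,
  -- exactly those before the end of the parent's range do.
  rw [h₁, pow_succ, mul_comm (2 ^ i) 2, ← mul_assoc, ← Nat.div_lt_iff_lt_mul (by positivity),
    mul_comm 2 (2 ^ i), ← Nat.div_div_eq_div_mul]
  omega

/-- A point before `A` lies either before the range of the ancestor or within it. The rank inside a
cell is thus a difference of two global ranks. -/
theorem rankBelow_eq_add {A C i j : ℕ} (hA₁ : 2 ^ (L + 2) ≤ A) (hA₂ : A < 2 ^ (L + 3))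
    (hC₁ : 2 ^ L ≤ C) (hC₂ : C < 2 ^ (L + 1)) (hi : i ≤ L) (hj : j ≤ L) :
    rankBelow L P (C / 2 ^ j) A = rankBelow L P (C / 2 ^ j) (A / 2 ^ i * 2 ^ i) +
      #((cell L P (A / 2 ^ i) (C / 2 ^ j)).filter (·.1 < A)) := by
  unfold rankBelow
  rw [← card_union_of_disjoint]
  · congr 1
    ext p
    simp only [mem_filter, mem_union, mem_cell hA₁ hA₂ hC₁ hC₂ hi hj, nodeHeight_div hC₁ hC₂ hj]
    have h₁ : p.1 < A → p.1 < A / 2 ^ i * 2 ^ i ∨ p.1 / 2 ^ i = A / 2 ^ i := by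
      intro h
      by_contra! hc
      have := (Nat.le_div_iff_mul_le (Nat.two_pow_pos i)).2 hc.1
      exact hc.2 (le_antisymm (Nat.div_le_div_right h.le) this)
    have h₂ : A / 2 ^ i * 2 ^ i ≤ A := Nat.div_mul_le_self _ _
    constructor
    · rintro ⟨hp, hy, hx⟩
      rcases h₁ hx with h | h
      · exact .inl ⟨hp, hy, h⟩
      · exact .inr ⟨⟨hp, h, hy⟩, hx⟩
    · rintro (⟨hp, hy, hx⟩ | ⟨⟨hp, hx, hy⟩, hx'⟩)
      · exact ⟨hp, hy, hx.trans_le h₂⟩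
      · exact ⟨hp, hy, hx'⟩
  · rw [Finset.disjoint_left]
    intro p h₁ h₂
    simp only [mem_filter, mem_cell hA₁ hA₂ hC₁ hC₂ hi hj] at h₁ h₂
    have := (Nat.div_lt_iff_lt_mul (Nat.two_pow_pos i)).2 h₁.2.2
    omega

end Cells

/-! ### Counting from a rounded starting position -/

/-- The position of `p` in the lexicographic order of a set of points. -/
def lexIndex (P : Finset (ℕ × ℕ)) (p : ℕ × ℕ) : ℕ :=
  #(P.filter fun q => q.1 < p.1 ∨ q.1 = p.1 ∧ q.2 < p.2)

theorem lexIndex_lt_of_lt {P : Finset (ℕ × ℕ)} {p q : ℕ × ℕ} (hp : p ∈ P)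
    (h : p.1 < q.1 ∨ p.1 = q.1 ∧ p.2 < q.2) : lexIndex P p < lexIndex P q := by
  refine card_lt_card ((Finset.ssubset_iff_of_subset fun r hr => ?_).2 ⟨p, ?_, ?_⟩)
  · simp only [mem_filter] at hr ⊢
    exact ⟨hr.1, by omega⟩
  · exact mem_filter.2 ⟨hp, h⟩
  · simp

theorem lexIndex_injOn (P : Finset (ℕ × ℕ)) : Set.InjOn (lexIndex P) P := by
  intro p hp q hq h
  by_contra hne
  have : p.1 ≠ q.1 ∨ p.2 ≠ q.2 := by
    by_contra! hc
    exact hne (Prod.ext hc.1 hc.2)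
  have h₁ := lexIndex_lt_of_lt (q := q) hp
  have h₂ := lexIndex_lt_of_lt (q := p) hq
  omega

/-- The number of points from position `start` on whose second coordinate exceeds `C`. -/
def suffixCount (P : Finset (ℕ × ℕ)) (start C : ℕ) : ℕ :=
  #(P.filter fun p => start ≤ lexIndex P p ∧ C < p.2)

/-- The points before `A` form an initial segment of the order, so a bound on the first coordinate
becomes a starting position. -/
theorem lexIndex_lt_iff {P : Finset (ℕ × ℕ)} {p : ℕ × ℕ} (hp : p ∈ P) (A : ℕ) :
    lexIndex P p < #(P.filter (·.1 < A)) ↔ p.1 < A := by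
  constructor
  · intro h
    by_contra! hA
    refine h.not_ge (card_le_card fun q hq => ?_)
    simp only [mem_filter] at hq ⊢
    exact ⟨hq.1, by omega⟩
  · intro h
    refine card_lt_card ((Finset.ssubset_iff_of_subset fun q hq => ?_).2 ⟨p, ?_, ?_⟩)
    · simp only [mem_filter] at hq ⊢
      exact ⟨hq.1, by omega⟩
    · exact mem_filter.2 ⟨hp, h⟩
    · simp

theorem le_suffixCount {P : Finset (ℕ × ℕ)} {A start : ℕ} (h : start ≤ #(P.filter (·.1 < A)))
    (C : ℕ) : #(P.filter fun p => A ≤ p.1 ∧ C < p.2) ≤ suffixCount P start C := by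
  refine card_le_card fun p hp => ?_
  simp only [mem_filter] at hp ⊢
  have := lexIndex_lt_iff hp.1 A
  exact ⟨hp.1, by omega, hp.2.2⟩

/-- Positions are distinct, so starting too early adds at most as many points as there are skipped
positions. -/
theorem suffixCount_le {P : Finset (ℕ × ℕ)} (A start C : ℕ) :
    suffixCount P start C ≤ #(P.filter fun p => A ≤ p.1 ∧ C < p.2) +
      (#(P.filter (·.1 < A)) - start) := by
  set r := #(P.filter (·.1 < A)) with hr
  have h : P.filter (fun p => start ≤ lexIndex P p ∧ C < p.2) ⊆
      P.filter (fun p => A ≤ p.1 ∧ C < p.2) ∪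
        P.filter (fun p => lexIndex P p ∈ Ico start r) := by
    intro p hp
    simp only [mem_filter, mem_union, mem_Ico] at hp ⊢
    have := lexIndex_lt_iff hp.1 A
    rw [← hr] at this
    by_cases hA : p.1 < A
    · exact .inr ⟨hp.1, hp.2.1, this.2 hA⟩
    · exact .inl ⟨hp.1, by omega, hp.2.2⟩
  refine (card_le_card h).trans ((card_union_le _ _).trans (Nat.add_le_add_left ?_ _))
  rw [← Nat.card_Ico]
  refine card_le_card_of_injOn (lexIndex P) (fun p hp => (mem_filter.1 hp).2) ?_
  exact (lexIndex_injOn P).mono fun p hp => (mem_filter.1 hp).1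

theorem suffixCount_antitone (P : Finset (ℕ × ℕ)) (start : ℕ) {C C' : ℕ} (h : C ≤ C') :
    suffixCount P start C' ≤ suffixCount P start C :=
  card_le_card fun p hp => by
    simp only [mem_filter] at hp ⊢
    exact ⟨hp.1, hp.2.1, by omega⟩

/-- For `C` below `M`, at least `t` points from position `start` on exceed `C` if and only if `C`
is below this threshold. -/
def threshold (M : ℕ) (P : Finset (ℕ × ℕ)) (start t : ℕ) : ℕ :=
  #((range M).filter fun C => t ≤ suffixCount P start C)

/-- The count decreases in `C`, so the admissible `C` form an initial segment of `range M`, and its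
size is the threshold. -/
theorem lt_threshold_iff {M : ℕ} {P : Finset (ℕ × ℕ)} {start t C : ℕ} (hC : C < M) :
    C < threshold M P start t ↔ t ≤ suffixCount P start C := by
  constructor
  · intro h
    by_contra! hc
    refine h.not_ge ((card_le_card fun C' hC' => ?_).trans (card_range C).le)
    rw [mem_range]
    by_contra! hle
    exact absurd ((mem_filter.1 hC').2.trans (suffixCount_antitone P start hle)) hc.not_ge
  · intro h
    rw [← Nat.succ_le_iff]
    refine (card_range (C + 1)).ge.trans (card_le_card fun C' hC' => ?_)
    rw [mem_range] at hC'
    exact mem_filter.2 ⟨mem_range.2 (by omega), h.trans (suffixCount_antitone P start (by omega))⟩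

/-! ### The scale of counts and the tables -/

/-- The counts that are distinguished: a floating point scale with mantissas of `s` bits, shifted
so that it starts at `0`. -/
def scale (s i : ℕ) : ℕ := (2 ^ s + i % 2 ^ s) * 2 ^ (i / 2 ^ s) - 2 ^ s

theorem scale_add (s i : ℕ) :
    scale s i + 2 ^ s = (2 ^ s + i % 2 ^ s) * 2 ^ (i / 2 ^ s) := by
  have : 2 ^ s * 1 ≤ (2 ^ s + i % 2 ^ s) * 2 ^ (i / 2 ^ s) :=
    Nat.mul_le_mul (Nat.le_add_right _ _) (Nat.one_le_two_pow)
  rw [scale]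
  omega

/-- The gap is `2 ^ j` for the exponent `j = i / 2 ^ s`, even when the mantissa overflows, as `2 ^
(s + 1) * 2 ^ j = 2 ^ s * 2 ^ (j + 1)`. -/
theorem scale_succ (s i : ℕ) : scale s (i + 1) = scale s i + 2 ^ (i / 2 ^ s) := by
  have h₁ := scale_add s i
  have h₂ := scale_add s (i + 1)
  have hpos : 0 < 2 ^ s := by positivity
  have hdm := Nat.div_add_mod i (2 ^ s)
  have hlt := Nat.mod_lt i hpos
  by_cases h : i % 2 ^ s + 1 = 2 ^ s
  · have e : i + 1 = 2 ^ s * (i / 2 ^ s + 1) := by rw [mul_add]; omega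
    have hd : (i + 1) / 2 ^ s = i / 2 ^ s + 1 := by
      rw [e, Nat.mul_div_cancel_left _ hpos]
    have hm : (i + 1) % 2 ^ s = 0 := by rw [e]; exact Nat.mul_mod_right _ _
    rw [hd, hm, pow_succ] at h₂
    have e₂ : i % 2 ^ s = 2 ^ s - 1 := by omega
    have : (2 ^ s + i % 2 ^ s) * 2 ^ (i / 2 ^ s) + 2 ^ (i / 2 ^ s) =
      (2 ^ s + 0) * (2 ^ (i / 2 ^ s) * 2) := by
      rw [← Nat.succ_mul, show (2 ^ s + i % 2 ^ s).succ = 2 ^ s * 2 by omega]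
      ring
    omega
  · have e : i + 1 = (i % 2 ^ s + 1) + 2 ^ s * (i / 2 ^ s) := by omega
    have hd : (i + 1) / 2 ^ s = i / 2 ^ s := by
      rw [e, Nat.add_mul_div_left _ _ hpos, Nat.div_eq_of_lt (by omega), zero_add]
    have hm : (i + 1) % 2 ^ s = i % 2 ^ s + 1 := by
      rw [e, Nat.add_mul_mod_self_left, Nat.mod_eq_of_lt (by omega)]
    rw [hd, hm, ← add_assoc, add_mul, one_mul] at h₂
    omega

/-- A power of two exceeding the size of a set, as an exponent. -/
def sizeLog (P : Finset (ℕ × ℕ)) : ℕ := Nat.log 2 #P + 1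

theorem card_lt_two_pow_sizeLog (P : Finset (ℕ × ℕ)) : #P < 2 ^ sizeLog P :=
  Nat.lt_pow_succ_log_self (by norm_num) _

theorem two_pow_sizeLog_le {P : Finset (ℕ × ℕ)} (hP : P.Nonempty) :
    2 ^ sizeLog P ≤ 2 * #P := by
  rw [sizeLog, pow_succ, mul_comm]
  exact Nat.mul_le_mul_left _ (Nat.pow_log_le_self 2 hP.card_pos.ne')

/-- The word at position `pos * 2 ^ s + q` of the table for the dominance queries in `P`. -/
def tableEntry (M s : ℕ) (P : Finset (ℕ × ℕ)) (pos q : ℕ) : ℕ :=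
  threshold M P (pos * 2 ^ nodeHeight (sizeLog P) pos - 2 ^ sizeLog P)
    ((2 ^ s + q) * 2 ^ nodeHeight (sizeLog P) pos - 2 ^ s)

/-- The count `scale s i` is reached by the points from position `r` on, rounded down. -/
def Reached (s : ℕ) (P : Finset (ℕ × ℕ)) (r C i : ℕ) : Prop :=
  scale s i ≤ suffixCount P (r / 2 ^ (i / 2 ^ s) * 2 ^ (i / 2 ^ s)) C

/-- Starting positions are leaves of another complete binary tree: the ancestor of `r` at height `j`
encodes both the exponent `j` and `r` rounded down to a multiple of `2 ^ j`. -/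
theorem lt_tableEntry_iff {M s : ℕ} {P : Finset (ℕ × ℕ)} {r C i : ℕ} (hr : r ≤ #P)
    (hi : i < sizeLog P * 2 ^ s) (hC : C < M) :
    C < tableEntry M s P ((2 ^ sizeLog P + r) / 2 ^ (i / 2 ^ s)) (i % 2 ^ s) ↔
      Reached s P r C i := by
  have hj : i / 2 ^ s ≤ sizeLog P :=
    (Nat.div_lt_of_lt_mul (by rwa [mul_comm])).le
  have hlt := card_lt_two_pow_sizeLog P
  rw [tableEntry, nodeHeight_div (by omega) (by rw [pow_succ]; omega) hj, lt_threshold_iff hC,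
    Reached, scale]
  have : (2 ^ sizeLog P + r) / 2 ^ (i / 2 ^ s) * 2 ^ (i / 2 ^ s) - 2 ^ sizeLog P =
      r / 2 ^ (i / 2 ^ s) * 2 ^ (i / 2 ^ s) := by
    have e : 2 ^ sizeLog P = 2 ^ (sizeLog P - i / 2 ^ s) * 2 ^ (i / 2 ^ s) := by
      rw [← pow_add]; congr 1; omega
    conv_lhs => rw [e]
    rw [add_comm, Nat.add_mul_div_right _ _ (by positivity), add_mul]
    omega
  rw [this]

theorem reached_zero (s : ℕ) (P : Finset (ℕ × ℕ)) (r C : ℕ) : Reached s P r C 0 := by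
  simp [Reached, scale]

theorem not_reached_top {s : ℕ} (hs : 1 ≤ s) {P : Finset (ℕ × ℕ)} (r C : ℕ) :
    ¬ Reached s P r C (sizeLog P * 2 ^ s) := by
  have h₁ : suffixCount P (r / 2 ^ (sizeLog P * 2 ^ s / 2 ^ s) *
      2 ^ (sizeLog P * 2 ^ s / 2 ^ s)) C ≤ #P := card_filter_le _ _
  have h₂ := card_lt_two_pow_sizeLog P
  have h₃ := scale_add s (sizeLog P * 2 ^ s)
  rw [Nat.mul_mod_left, Nat.mul_div_cancel _ (by positivity)] at h₃
  have h₄ : 2 ^ 1 ≤ 2 ^ s := Nat.pow_le_pow_right (by norm_num) hs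
  have h₅ : 2 ^ 1 ≤ 2 ^ sizeLog P := Nat.pow_le_pow_right (by norm_num) (by simp [sizeLog])
  unfold Reached
  nlinarith

/-- The last count that is reached is a good approximation. -/
theorem scale_approx {s : ℕ} (hs : 2 ≤ s) {P : Finset (ℕ × ℕ)} {A C i : ℕ}
    (h₁ : Reached s P #(P.filter (·.1 < A)) C i)
    (h₂ : ¬ Reached s P #(P.filter (·.1 < A)) C (i + 1)) :
    2 ^ s * scale s i ≤ (2 ^ s + 4) * #(P.filter fun p => A ≤ p.1 ∧ C < p.2) ∧
    2 ^ s * #(P.filter fun p => A ≤ p.1 ∧ C < p.2) ≤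
      2 ^ s * scale s i + 4 * #(P.filter fun p => A ≤ p.1 ∧ C < p.2) := by
  set k := #(P.filter fun p => A ≤ p.1 ∧ C < p.2)
  set r := #(P.filter (·.1 < A)) with hr
  unfold Reached at h₁ h₂
  have h₃ := suffixCount_le (P := P) A (r / 2 ^ (i / 2 ^ s) * 2 ^ (i / 2 ^ s)) C
  have h₄ := le_suffixCount (P := P) (A := A)
    (start := r / 2 ^ ((i + 1) / 2 ^ s) * 2 ^ ((i + 1) / 2 ^ s)) (Nat.div_mul_le_self _ _) C
  rw [← hr] at h₃
  have h₅ : r - r / 2 ^ (i / 2 ^ s) * 2 ^ (i / 2 ^ s) < 2 ^ (i / 2 ^ s) := by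
    have := Nat.div_add_mod' r (2 ^ (i / 2 ^ s))
    have := Nat.mod_lt r (Nat.two_pow_pos (i / 2 ^ s))
    omega
  rw [scale_succ] at h₂
  have h₆ := scale_add s i
  have h₇ : 2 ^ 2 ≤ 2 ^ s := Nat.pow_le_pow_right (by norm_num) hs
  set τ := scale s i
  have h₈ : τ < k + 2 ^ (i / 2 ^ s) := by omega
  have h₉ : k < τ + 2 ^ (i / 2 ^ s) := by omega
  rcases Nat.eq_zero_or_pos (i / 2 ^ s) with hj | hj
  -- With exponent `0` nothing is rounded and the gap is `1`, so the answer is exact. In particular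
  -- an empty query gets `0`.
  · rw [hj] at h₈ h₉
    have : τ = k := by omega
    rw [this]
    constructor <;> nlinarith
  · have hj : 2 ^ 1 ≤ 2 ^ (i / 2 ^ s) := Nat.pow_le_pow_right (by norm_num) hj
    generalize 2 ^ (i / 2 ^ s) = y at *
    generalize 2 ^ s = x at *
    -- Here the error is below `y`. Since `y ≥ 2`, the shift `x` of the scale costs at most half of
    -- `x * y`, and `x ≥ 4` then turns `x * y ≤ 2 * τ` into `y ≤ 4 * k / x`.
    have h₁₀ : x * y ≤ τ + x := by rw [h₆]; exact Nat.mul_le_mul_right _ (Nat.le_add_right _ _)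
    have h₁₁ : x * y ≤ 2 * τ := by nlinarith
    have h₁₂ : x * y ≤ 4 * k := by nlinarith
    constructor <;> nlinarith

/-! ### The memory layout -/

/-- The number of words that suffice for the data structure, in terms of the height `L` of the
tree, the number `N` of points and the precision `s`. -/
def spaceBound (L s N : ℕ) : ℕ := 26 * 2 ^ L + 29 * 2 ^ s * (N * L ^ 2 + 1)

/-- The memory `m` of `S` words of `w` bits holds the data structure for the points `P`. Word `0`
holds the height of the tree; the record of the pair of nodes `u, v` is at `m (m v + u) + 8 * v`. -/
structure Layout (L s w : ℕ) (P : Finset (ℕ × ℕ)) (S : ℕ) (m : ℕ → ℕ) : Prop where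
  lt_two_pow : ∀ z < S, m z < 2 ^ w
  leaves_le : 26 * 2 ^ L ≤ S
  height : m 0 = L
  row_lt : ∀ u v, u < 2 ^ (L + 3) → v < 2 ^ (L + 1) → 1 ≤ v → m v + u < S
  record_lt : ∀ u v, u < 2 ^ (L + 3) → v < 2 ^ (L + 1) → 1 ≤ v → m (m v + u) + 8 * v + 5 < S
  mem_iff : ∀ u v, u < 2 ^ (L + 3) → v < 2 ^ (L + 1) → 1 ≤ v → 1 ≤ u →
    ((m (m (m v + u) + 8 * v) = u ∧ m (m (m v + u) + 8 * v + 1) = v) ↔ (u, v) ∈ cells L P)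
  rank : ∀ u v, (u, v) ∈ cells L P → ∀ x < 2, m (m (m v + u) + 8 * v + 2 + x) =
    rankBelow L P v ((u + x) * 2 ^ nodeHeight (L + 2) u)
  size : ∀ u v, (u, v) ∈ cells L P → m (m (m v + u) + 8 * v + 5) = sizeLog (cell L P u v)
  table_le : ∀ u v, (u, v) ∈ cells L P →
    m (m (m v + u) + 8 * v + 4) + 2 * 2 ^ sizeLog (cell L P u v) * 2 ^ s ≤ S
  table : ∀ u v, (u, v) ∈ cells L P → ∀ pos < 2 * 2 ^ sizeLog (cell L P u v), ∀ q < 2 ^ s,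
    m (m (m (m v + u) + 8 * v + 4) + (pos * 2 ^ s + q)) =
      tableEntry (2 ^ (L + 1)) s (cell L P u v) pos q

/-- The record of a pair of nodes; `base` is the address of its table. -/
def recordField (L : ℕ) (P : Finset (ℕ × ℕ)) (base : ℕ × ℕ → ℕ) (k : ℕ × ℕ) : ℕ → ℕ
  | 0 => k.1
  | 1 => k.2
  | 2 => rankBelow L P k.2 ((k.1 + 0) * 2 ^ nodeHeight (L + 2) k.1)
  | 3 => rankBelow L P k.2 ((k.1 + 1) * 2 ^ nodeHeight (L + 2) k.1)
  | 4 => base k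
  | 5 => sizeLog (cell L P k.1 k.2)
  | _ => 0

theorem mem_cells_bounds {L : ℕ} {P : Finset (ℕ × ℕ)} (hP : AreLeaves L P) {u v : ℕ}
    (hk : (u, v) ∈ cells L P) : u < 2 ^ (L + 3) ∧ v < 2 ^ (L + 1) ∧ 1 ≤ v ∧ 1 ≤ u := by
  obtain ⟨A, C, i, j, hA, hC, hi, hj, he⟩ := exists_of_mem_cells hP hk
  obtain ⟨rfl, rfl⟩ := Prod.mk.inj he
  refine ⟨(Nat.div_le_self _ _).trans_lt hA.2, (Nat.div_le_self _ _).trans_lt hC.2, ?_, ?_⟩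
  · exact Nat.div_pos ((Nat.pow_le_pow_right (by norm_num) hj.le).trans hC.1) (by positivity)
  · exact Nat.div_pos ((Nat.pow_le_pow_right (by norm_num) (by omega)).trans hA.1) (by positivity)

theorem cell_nonempty {L : ℕ} {P : Finset (ℕ × ℕ)} (hP : AreLeaves L P) {k : ℕ × ℕ}
    (hk : k ∈ cells L P) : (cell L P k.1 k.2).Nonempty := by
  obtain ⟨A, C, i, j, hA, hC, hi, hj, rfl⟩ := exists_of_mem_cells hP hk
  exact (mem_cells hP hA.1 hA.2 hC.1 hC.2 hi hj).1 hk

set_option maxHeartbeats 1000000 in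
open Classical in
-- The memory consists of the height, the column displacements, the row displacements, the hashed
-- records and the tables. Displacements are stored as ready addresses. A node pair is recognized by
-- comparing it with the pair stored in its slot.
theorem exists_layout {L s w : ℕ} {P : Finset (ℕ × ℕ)} (hL : 1 ≤ L) (hP : AreLeaves L P)
    (hw : spaceBound L s #P < 2 ^ w) :
    ∃ S m, S ≤ spaceBound L s #P ∧ Layout L s w P S m := by
  set K := cells L P with hKdef
  set R := #P * L ^ 2 + 1 with hR
  have hNR : #P ≤ R := by nlinarith [Nat.one_le_pow 2 L hL]
  obtain ⟨c, r, hc, hr, hinj⟩ := exists_perfect_hash (R := R) (by omega) K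
    (card_cells_le.trans (Nat.le_succ _))
  set W := 2 ^ L with hW
  have hW₁ : 2 ^ (L + 1) = 2 * W := by rw [pow_succ, mul_comm]
  have hW₃ : 2 ^ (L + 3) = 8 * W := by rw [pow_add]; omega
  have hLW : L < W := Nat.lt_two_pow_self
  let size : ℕ × ℕ → ℕ := fun k => 2 * 2 ^ sizeLog (cell L P k.1 k.2) * 2 ^ s
  have hsize : ∑ k ∈ K, size k ≤ 4 * 2 ^ s * (#P * L ^ 2) := by
    refine le_trans ?_ (Nat.mul_le_mul_left _ (sum_card_cell_le hP))
    rw [mul_sum]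
    refine sum_le_sum fun k hk => ?_
    have := Nat.mul_le_mul_right (2 ^ s) (two_pow_sizeLog_le (cell_nonempty hP hk))
    simp only [size]
    nlinarith
  -- There are `2 * W` column entries (entry `0` holds the height), `8 * W + R` row entries, and
  -- eight words for each of `2 * R + 2 * W` slots: `26 * W + 17 * R` words before the tables.
  set r₀ := 2 * W with hr₀
  set s₀ := r₀ + 8 * W + R with hs₀
  set o := s₀ + 8 * (2 * R + 2 * W) with ho
  -- The table addresses are chosen before any contents, because the records have to store them.
  obtain ⟨base, hbase, hfill⟩ := exists_allocation K size o
  let slot : ℕ × ℕ → ℕ := fun k => r (k.1 + c k.2) + k.2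
  let content : ℕ → ℕ → ℕ := fun t f =>
    if h : ∃ k ∈ K, slot k = t then recordField L P base h.choose f else 0
  let m₀ : ℕ → ℕ := fun z => if z = 0 then L else if z < r₀ then r₀ + c z else
    if z < s₀ then s₀ + 8 * r (z - r₀) else content ((z - s₀) / 8) ((z - s₀) % 8)
  obtain ⟨m, hm₀, hm, hmB⟩ := hfill m₀ fun k z =>
    tableEntry (2 ^ (L + 1)) s (cell L P k.1 k.2) (z / 2 ^ s) (z % 2 ^ s)
  set S := o + ∑ k ∈ K, size k with hS
  have hSb : S ≤ spaceBound L s #P := by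
    have : 1 ≤ 2 ^ s := Nat.one_le_two_pow
    simp only [spaceBound, ← hR, ← hW]
    have h₁ : #P * L ^ 2 ≤ R := Nat.le_succ _
    have h₂ : 4 * 2 ^ s * (#P * L ^ 2) ≤ 4 * 2 ^ s * R := Nat.mul_le_mul_left _ h₁
    have h₃ : 25 * R ≤ 25 * 2 ^ s * R := Nat.mul_le_mul_right _ (by omega)
    nlinarith
  have hrow : ∀ u v, u < 2 ^ (L + 3) → v < 2 ^ (L + 1) → 1 ≤ v →
      m v = r₀ + c v ∧ m (m v + u) = s₀ + 8 * r (u + c v) ∧ m v + u < s₀ := by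
    intro u v hu hv hv₁
    have h₁ : m v = r₀ + c v := by
      rw [hm₀ v (by omega)]
      simp only [m₀]
      rw [if_neg (by omega), if_pos (by omega)]
    have := hc v
    refine ⟨h₁, ?_, by omega⟩
    rw [hm₀ _ (by omega)]
    simp only [m₀]
    rw [if_neg (by omega), if_neg (by omega), if_pos (by omega)]
    congr 4
    omega
  have hrec : ∀ u v, u < 2 ^ (L + 3) → v < 2 ^ (L + 1) → 1 ≤ v → ∀ f < 8,
      m (m (m v + u) + 8 * v + f) = content (slot (u, v)) f := by
    intro u v hu hv hv₁ f hf
    obtain ⟨h₁, h₂, -⟩ := hrow u v hu hv hv₁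
    have := hr (u + c v)
    have e : m (m v + u) + 8 * v + f = s₀ + (8 * slot (u, v) + f) := by
      rw [h₂]; simp only [slot]; ring
    have hslot : slot (u, v) < 2 * R + 2 * W := by simp only [slot]; omega
    rw [e, hm₀ _ (by omega)]
    simp only [m₀]
    rw [if_neg (by omega), if_neg (by omega), if_neg (by omega), Nat.add_sub_cancel_left]
    congr 1 <;> omega
  have hcontent : ∀ k ∈ K, ∀ f, content (slot k) f = recordField L P base k f := by
    intro k hk f
    have h : ∃ k' ∈ K, slot k' = slot k := ⟨k, hk, rfl⟩
    simp only [content]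
    rw [dif_pos h]
    congr 1
    exact hinj h.choose_spec.1 hk h.choose_spec.2
  have hrecK : ∀ u v, (u, v) ∈ K → ∀ f < 8,
      m (m (m v + u) + 8 * v + f) = recordField L P base (u, v) f := by
    intro u v hk f hf
    obtain ⟨hu, hv, hv₁, -⟩ := mem_cells_bounds hP hk
    rw [hrec u v hu hv hv₁ f hf, hcontent _ hk]
  have hrank : ∀ v A, rankBelow L P v A < spaceBound L s #P := by
    intro v A
    refine (card_filter_le _ _).trans_lt ?_
    have : 1 ≤ 2 ^ s := Nat.one_le_two_pow
    simp only [spaceBound, ← hR]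
    nlinarith
  have hfield : ∀ k ∈ K, ∀ f, recordField L P base k f < spaceBound L s #P := by
    intro k hk f
    obtain ⟨hu, hv, -⟩ := mem_cells_bounds hP (u := k.1) (v := k.2) hk
    have h₁ := hbase k hk
    have h₂ : 2 ^ sizeLog (cell L P k.1 k.2) ≤ size k :=
      (Nat.le_mul_of_pos_left _ two_pos).trans (Nat.le_mul_of_pos_right _ (Nat.two_pow_pos s))
    have h₃ : sizeLog (cell L P k.1 k.2) < 2 ^ sizeLog (cell L P k.1 k.2) := Nat.lt_two_pow_self
    unfold recordField
    split
    · omega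
    · omega
    · exact hrank _ _
    · exact hrank _ _
    · omega
    · omega
    · omega
  refine ⟨S, m, hSb, ⟨?_, by omega, ?_, ?_, ?_, ?_, ?_, ?_, ?_, ?_⟩⟩
  · intro z hz
    refine lt_of_lt_of_le (hmB _ (fun z hz => ?_) (fun k hk z => ?_) z hz) hw.le
    · simp only [m₀]
      split_ifs with h₁ h₂ h₃
      · omega
      · have := hc z; omega
      · have := hr (z - r₀); omega
      · simp only [content]
        split_ifs with h
        · exact hfield _ h.choose_spec.1 _
        · omega
    · refine lt_of_le_of_lt ((card_filter_le _ _).trans (card_range _).le) ?_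
      omega
  · rw [hm₀ 0 (by omega)]; simp [m₀]
  · intro u v hu hv hv₁
    have := (hrow u v hu hv hv₁).2.2
    omega
  · intro u v hu hv hv₁
    obtain ⟨h₁, h₂, -⟩ := hrow u v hu hv hv₁
    have := hr (u + c v)
    omega
  · intro u v hu hv hv₁ hu₁
    have e₀ := hrec u v hu hv hv₁ 0 (by omega)
    have e₁ := hrec u v hu hv hv₁ 1 (by omega)
    rw [add_zero] at e₀
    rw [e₀, e₁]
    constructor
    · rintro ⟨h₁, h₂⟩
      by_cases h : ∃ k ∈ K, slot k = slot (u, v)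
      · obtain ⟨k, hk, hks⟩ := h
        rw [← hks, hcontent k hk] at h₁ h₂
        have : k = (u, v) := Prod.ext h₁ h₂
        exact this ▸ hk
      -- An unused slot holds `0`, which is not the number of a node.
      · simp only [content] at h₁
        rw [dif_neg h] at h₁
        omega
    · intro hk
      rw [hcontent _ hk, hcontent _ hk]
      exact ⟨rfl, rfl⟩
  · intro u v hk x hx
    rw [add_assoc, hrecK u v hk _ (by omega)]
    interval_cases x <;> rfl
  · intro u v hk
    exact hrecK u v hk 5 (by omega)
  · intro u v hk
    rw [hrecK u v hk 4 (by omega)]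
    exact (hbase _ hk).2
  · intro u v hk pos hpos q hq
    rw [hrecK u v hk 4 (by omega)]
    have hlt : pos * 2 ^ s + q < size (u, v) := by
      simp only [size]
      calc pos * 2 ^ s + q < (pos + 1) * 2 ^ s := by rw [add_mul]; omega
        _ ≤ _ := Nat.mul_le_mul_right _ hpos
    refine (hm (u, v) hk _ hlt).trans ?_
    rw [add_comm (pos * 2 ^ s), Nat.add_mul_div_right _ _ (by positivity), Nat.div_eq_of_lt hq,
      Nat.add_mul_mod_self_right, Nat.mod_eq_of_lt hq, zero_add]

/-! ### Finding split levels and ranks -/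

/-- `l` is the height below which the ancestors of the leaves `A` and `B` differ. -/
def SplitLevel (A B l : ℕ) : Prop :=
  A / 2 ^ l ≠ B / 2 ^ l ∧ A / 2 ^ (l + 1) = B / 2 ^ (l + 1)

namespace WordRAM

/-- Find the split level of the leaves in two registers. -/
def findSplit (x y : ℕ) : Cmd :=
  .seq (.assign 8 (.lit 0)) (.seq (.assign 9 (.var 4))
    (bsearch (.lit 0) (.bin .xor (.bin .shr (.var x) (.var 10)) (.bin .shr (.var y) (.var 10)))))

theorem exec_findSplit {w S : ℕ} {m s : ℕ → ℕ} {x y k : ℕ} (hx : 10 < x) (hy : 10 < y)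
    (hx' : x < 32) (hy' : y < 32) (h₀ : s x ≠ s y) (h₁ : s x / 2 ^ s 4 = s y / 2 ^ s 4)
    (hk : s 4 ≤ 2 ^ k) (hw : 2 * s 4 < 2 ^ w) :
    ∃ s', Exec w S m (findSplit x y) s (28 * (k + 1)) s' ∧ s' 8 < s 4 ∧
      SplitLevel (s x) (s y) (s' 8) ∧ ∀ r, r ≠ 8 → r ≠ 9 → r ≠ 10 → s' r = s r := by
  have hpos : 0 < 2 ^ w := by positivity
  have hL : 0 < s 4 := Nat.pos_of_ne_zero fun h => by simp [h] at h₁; exact h₀ h₁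
  have e₁ := Exec.assign (w := w) (S := S) (m := m) (x := 8) (e := .lit 0) (s := s) hpos
  have e₂ := Exec.assign (w := w) (S := S) (m := m) (x := 9) (e := .var 4)
    (s := Function.update s 8 0) (by simp [Expr.Safe])
  simp only [Expr.eval] at e₁ e₂
  rw [show Function.update s 8 0 4 = s 4 by simp] at e₂
  obtain ⟨s', hex, h8, h8', hq, hnq, hrest⟩ := exec_bsearch (w := w) (S := S) (m := m)
    (x := .lit 0)
    (y := .bin .xor (.bin .shr (.var x) (.var 10)) (.bin .shr (.var y) (.var 10)))
    (Q := fun i => s x / 2 ^ i ≠ s y / 2 ^ i) k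
    (s := Function.update (Function.update s 8 0) 9 (s 4)) (by simpa using hL) (by simpa using hw)
    (by simpa using h₀) (by simpa using h₁) (by simpa using hk)
    (fun i _ _ s' hs' hi => by
      have ex : s' x = s x := by
        rw [hs' x (by omega) (by omega) (by omega)]
        simp [show x ≠ 8 by omega, show x ≠ 9 by omega]
      have ey : s' y = s y := by
        rw [hs' y (by omega) (by omega) (by omega)]
        simp [show y ≠ 8 by omega, show y ≠ 9 by omega]
      refine ⟨hpos, ?_, ?_⟩
      · simp [Expr.Safe, BinOp.NoOverflow, hx', hy']
      · simp [Expr.eval, BinOp.natEval, ex, ey, hi, Nat.pos_iff_ne_zero])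
  refine ⟨s', (e₁.seq (e₂.seq hex)).mono ?_, by simpa using h8', ⟨hq, not_not.1 hnq⟩,
    fun r h8 h9 h10 => ?_⟩
  · simp only [Expr.len]; omega
  · rw [hrest r h8 h9 h10]; simp [h8, h9]

/-- The address of the record of a pair of nodes. -/
def recordAddr (u v : Expr) : Expr :=
  .bin .add (.load (.bin .add (.load v) u)) (.bin .shl v (.lit 3))

/-- Positive if the pair of nodes has no record. -/
def missing (u v : Expr) : Expr :=
  .bin .or (.bin .xor (.load (recordAddr u v)) u)
    (.bin .xor (.load (.bin .add (recordAddr u v) (.lit 1))) v)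

section Layout

variable {L s w S : ℕ} {P : Finset (ℕ × ℕ)} {m : ℕ → ℕ}

theorem eval_recordAddr (σ : ℕ → ℕ) (u v : Expr) :
    (recordAddr u v).eval m σ = m (m (v.eval m σ) + u.eval m σ) + 8 * v.eval m σ := by
  simp [recordAddr, Expr.eval, BinOp.natEval]; ring

theorem safe_recordAddr (hl : Layout L s w P S m) (hw : 8 * S < 2 ^ w) {σ : ℕ → ℕ} {u v : Expr}
    (hu : u.Safe w S m σ) (hv : v.Safe w S m σ) (hu' : u.eval m σ < 2 ^ (L + 3))
    (hv' : v.eval m σ < 2 ^ (L + 1)) (hv₁ : 1 ≤ v.eval m σ) :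
    (recordAddr u v).Safe w S m σ := by
  have h₁ := hl.row_lt _ _ hu' hv' hv₁
  have h₂ := hl.record_lt _ _ hu' hv' hv₁
  have h₃ := hl.leaves_le
  rw [pow_succ] at hv'
  simp only [recordAddr, Expr.Safe, Expr.eval, BinOp.NoOverflow, BinOp.natEval]
  refine ⟨⟨⟨⟨hv, ?_⟩, hu, ?_⟩, ?_⟩, ⟨hv, ?_, ?_⟩, ?_⟩ <;> omega

theorem safe_missing (hl : Layout L s w P S m) (hw : 8 * S < 2 ^ w) {σ : ℕ → ℕ} {u v : Expr}
    (hu : u.Safe w S m σ) (hv : v.Safe w S m σ) (hu' : u.eval m σ < 2 ^ (L + 3))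
    (hv' : v.eval m σ < 2 ^ (L + 1)) (hv₁ : 1 ≤ v.eval m σ) :
    (missing u v).Safe w S m σ := by
  have h := safe_recordAddr hl hw hu hv hu' hv' hv₁
  have h₂ := hl.record_lt _ _ hu' hv' hv₁
  simp only [missing, Expr.Safe, BinOp.NoOverflow, Expr.eval, BinOp.natEval, eval_recordAddr]
  refine ⟨⟨⟨h, ?_⟩, hu, trivial⟩, ⟨⟨⟨h, ?_, ?_⟩, ?_⟩, hv, trivial⟩, trivial⟩ <;> omega

theorem eval_missing (hl : Layout L s w P S m) {σ : ℕ → ℕ} {u v : Expr}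
    (hu' : u.eval m σ < 2 ^ (L + 3)) (hv' : v.eval m σ < 2 ^ (L + 1)) (hv₁ : 1 ≤ v.eval m σ)
    (hu₁ : 1 ≤ u.eval m σ) :
    0 < (missing u v).eval m σ ↔ (u.eval m σ, v.eval m σ) ∉ cells L P := by
  rw [← hl.mem_iff _ _ hu' hv' hv₁ hu₁]
  simp only [missing, Expr.eval, BinOp.natEval, eval_recordAddr, Nat.pos_iff_ne_zero, ne_eq,
    Nat.or_eq_zero_iff, Nat.xor_eq_zero_iff]

/-- With the leaf `A` in register `11`, the split level in `15` and the second node in `16`, find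
the rank of `A` in the cell. -/
def findRank : Cmd :=
  .seq (.assign 17 (recordAddr (.bin .shr (.var 11) (.var 15)) (.var 16)))
  (.seq (.assign 18 (.load (.bin .add (.var 17) (.lit 2))))
  (.seq (.assign 19 (.load (.bin .add (.var 17) (.lit 4))))
  (.seq (.assign 20 (.load (.bin .add (.var 17) (.lit 5))))
  (.seq (.assign 8 (.lit 0))
  (.seq (.assign 9 (.var 15))
  (.seq (bsearch (.lit 0) (missing (.bin .shr (.var 11) (.var 10)) (.var 16)))
  (.seq (.assign 17 (recordAddr (.bin .shr (.var 11) (.bin .add (.var 8) (.lit 1))) (.var 16)))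
    (.assign 18 (.bin .add (.bin .shl (.lit 1) (.var 20))
      (.bin .sub (.load (.bin .add (.bin .add (.var 17) (.lit 2))
        (.bin .and (.bin .shr (.var 11) (.var 8)) (.lit 1)))) (.var 18)))))))))))

/-- The search over the ancestors of `A` starts from height `0`, where the cell is empty as no point
has first coordinate `A`, and height `l`, where it is not. Adding `2 ^ sizeLog` makes the rank a
leaf of the tree of starting positions. -/
theorem exec_findRank (hP : AreLeaves L P) (hl : Layout L s w P S m) (hw : 8 * S < 2 ^ w)
    {A C l j k : ℕ} (hA₁ : 2 ^ (L + 2) ≤ A) (hA₂ : A < 2 ^ (L + 3)) (hC₁ : 2 ^ L ≤ C)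
    (hC₂ : C < 2 ^ (L + 1)) (hl₀ : 0 < l) (hlL : l < L) (hj : j < L) (hk : L ≤ 2 ^ k)
    (hAP : ∀ p ∈ P, p.1 ≠ A) (hcell : (A / 2 ^ l, C / 2 ^ j) ∈ cells L P)
    {σ : ℕ → ℕ} (h11 : σ 11 = A) (h15 : σ 15 = l) (h16 : σ 16 = C / 2 ^ j) :
    ∃ σ', Exec w S m findRank σ (200 * (k + 1)) σ' ∧ (∀ r < 8, σ' r = σ r) ∧ σ' 13 = σ 13 ∧
      σ' 18 = 2 ^ sizeLog (cell L P (A / 2 ^ l) (C / 2 ^ j)) +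
        #((cell L P (A / 2 ^ l) (C / 2 ^ j)).filter (·.1 < A)) ∧
      σ' 19 = m (m (m (C / 2 ^ j) + A / 2 ^ l) + 8 * (C / 2 ^ j) + 4) ∧
      σ' 20 = sizeLog (cell L P (A / 2 ^ l) (C / 2 ^ j)) := by
  have hpos : 0 < 2 ^ w := by positivity
  set v := C / 2 ^ j with hv
  have hnode : ∀ i, A / 2 ^ i < 2 ^ (L + 3) := fun i => (Nat.div_le_self _ _).trans_lt hA₂
  have hnode₁ : ∀ i ≤ L, 1 ≤ A / 2 ^ i := fun i hi =>
    Nat.div_pos ((Nat.pow_le_pow_right (by norm_num) (by omega)).trans hA₁) (by positivity)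
  have hv₁ : 1 ≤ v :=
    Nat.div_pos ((Nat.pow_le_pow_right (by norm_num) (by omega)).trans hC₁) (by positivity)
  have hv₂ : v < 2 ^ (L + 1) := (Nat.div_le_self _ _).trans_lt hC₂
  have hLS : 26 * 2 ^ L ≤ S := hl.leaves_le
  have hLW : L < 2 ^ L := Nat.lt_two_pow_self
  have hrec := hl.record_lt _ _ (hnode l) hv₂ hv₁
  have e₁ := Exec.assign (x := 17)
    (safe_recordAddr hl hw (σ := σ) (u := .bin .shr (.var 11) (.var 15)) (v := .var 16)
    (by simp [Expr.Safe, BinOp.NoOverflow]) (by simp [Expr.Safe])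
    (by simpa [Expr.eval, BinOp.natEval, h11, h15] using hnode l)
    (by simpa [Expr.eval, h16] using hv₂) (by simpa [Expr.eval, h16] using hv₁))
  rw [eval_recordAddr] at e₁
  simp only [Expr.eval, BinOp.natEval, h11, h15, h16] at e₁
  set e := m (m v + A / 2 ^ l) + 8 * v with he
  set σ₁ := Function.update σ 17 e with hσ₁
  have e₂ := Exec.assign (w := w) (S := S) (m := m) (s := σ₁) (x := 18)
    (e := .load (.bin .add (.var 17) (.lit 2)))
    (by simp only [Expr.Safe, Expr.eval, BinOp.NoOverflow, BinOp.natEval, hσ₁,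
          Function.update_self]; omega)
  simp only [Expr.eval, BinOp.natEval, hσ₁, Function.update_self] at e₂
  rw [← hσ₁] at e₂
  set σ₂ := Function.update σ₁ 18 (m (e + 2)) with hσ₂
  have h17 : σ₂ 17 = e := by simp [hσ₂, hσ₁]
  have e₃ := Exec.assign (w := w) (S := S) (m := m) (s := σ₂) (x := 19)
    (e := .load (.bin .add (.var 17) (.lit 4)))
    (by simp only [Expr.Safe, Expr.eval, BinOp.NoOverflow, BinOp.natEval, h17]; omega)
  simp only [Expr.eval, BinOp.natEval, h17] at e₃
  set σ₃ := Function.update σ₂ 19 (m (e + 4)) with hσ₃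
  have h17 : σ₃ 17 = e := by simp [hσ₃, hσ₂, hσ₁]
  have e₄ := Exec.assign (w := w) (S := S) (m := m) (s := σ₃) (x := 20)
    (e := .load (.bin .add (.var 17) (.lit 5)))
    (by simp only [Expr.Safe, Expr.eval, BinOp.NoOverflow, BinOp.natEval, h17]; omega)
  simp only [Expr.eval, BinOp.natEval, h17] at e₄
  set σ₄ := Function.update σ₃ 20 (m (e + 5)) with hσ₄
  have e₅ := Exec.assign (w := w) (S := S) (m := m) (s := σ₄) (x := 8) (e := .lit 0) hpos
  simp only [Expr.eval] at e₅
  set σ₅ := Function.update σ₄ 8 0 with hσ₅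
  have e₆ := Exec.assign (w := w) (S := S) (m := m) (s := σ₅) (x := 9) (e := .var 15)
    (by simp [Expr.Safe])
  have h15' : σ₅ 15 = l := by simp [hσ₅, hσ₄, hσ₃, hσ₂, hσ₁, h15]
  simp only [Expr.eval, h15'] at e₆
  set σ₆ := Function.update σ₅ 9 l with hσ₆
  have f11 : σ₆ 11 = A := by simp [hσ₆, hσ₅, hσ₄, hσ₃, hσ₂, hσ₁, h11]
  have f16 : σ₆ 16 = v := by simp [hσ₆, hσ₅, hσ₄, hσ₃, hσ₂, hσ₁, h16]
  have f8 : σ₆ 8 = 0 := by simp [hσ₆, hσ₅]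
  have f9 : σ₆ 9 = l := by simp [hσ₆]
  have f18 : σ₆ 18 = m (e + 2) := by simp [hσ₆, hσ₅, hσ₄, hσ₃, hσ₂]
  have f19 : σ₆ 19 = m (e + 4) := by simp [hσ₆, hσ₅, hσ₄, hσ₃]
  have f20 : σ₆ 20 = m (e + 5) := by simp [hσ₆, hσ₅, hσ₄]
  have f13 : σ₆ 13 = σ 13 := by simp [hσ₆, hσ₅, hσ₄, hσ₃, hσ₂, hσ₁]
  have flow : ∀ r < 8, σ₆ r = σ r := fun r hr => by
    simp [hσ₆, hσ₅, hσ₄, hσ₃, hσ₂, hσ₁, show r ≠ 8 by omega, show r ≠ 9 by omega,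
      show r ≠ 17 by omega, show r ≠ 18 by omega, show r ≠ 19 by omega, show r ≠ 20 by omega]
  obtain ⟨σ₇, e₇, -, h8', hq, hnq, hrest⟩ := exec_bsearch (w := w) (S := S) (m := m)
    (x := .lit 0) (y := missing (.bin .shr (.var 11) (.var 10)) (.var 16))
    (Q := fun i => (A / 2 ^ i, v) ∉ cells L P) k (s := σ₆)
    (by omega) (by omega)
    (by
      rw [f8, hv, mem_cells hP hA₁ hA₂ hC₁ hC₂ (by omega) hj]
      rintro ⟨p, hp⟩
      have := (mem_cell hA₁ hA₂ hC₁ hC₂ (by omega) hj.le).1 hp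
      exact hAP p this.1 (by simpa using this.2.1))
    (by rw [f9]; exact not_not.2 hcell) (by omega)
    (fun i _ hi s' hs' hi' => by
      have g11 : s' 11 = A := by rw [hs' 11 (by omega) (by omega) (by omega), f11]
      have g16 : s' 16 = v := by rw [hs' 16 (by omega) (by omega) (by omega), f16]
      have hE : (Expr.bin .shr (.var 11) (.var 10)).eval m s' = A / 2 ^ i := by
        simp [Expr.eval, BinOp.natEval, g11, hi']
      have hE' : (Expr.var 16).eval m s' = v := g16
      refine ⟨hpos, safe_missing hl hw (by simp [Expr.Safe, BinOp.NoOverflow])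
        (by simp [Expr.Safe]) ?_ ?_ ?_, ?_⟩
      · rw [hE]; exact hnode i
      · rw [hE']; exact hv₂
      · rw [hE']; exact hv₁
      · have := eval_missing hl (σ := s') (u := .bin .shr (.var 11) (.var 10)) (v := .var 16)
          (by rw [hE]; exact hnode i) (by rw [hE']; exact hv₂) (by rw [hE']; exact hv₁)
          (by rw [hE]; exact hnode₁ i (by omega))
        rw [hE, hE'] at this
        exact this)
  set i := σ₇ 8 with hi
  have g11 : σ₇ 11 = A := by rw [hrest 11 (by omega) (by omega) (by omega), f11]
  have g16 : σ₇ 16 = v := by rw [hrest 16 (by omega) (by omega) (by omega), f16]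
  have g18 : σ₇ 18 = m (e + 2) := by rw [hrest 18 (by omega) (by omega) (by omega), f18]
  have g20 : σ₇ 20 = sizeLog (cell L P (A / 2 ^ l) v) := by
    rw [hrest 20 (by omega) (by omega) (by omega), f20]
    exact hl.size _ _ hcell
  have hi₁ : i + 1 ≤ l := by omega
  have hrec' := hl.record_lt _ _ (hnode (i + 1)) hv₂ hv₁
  have e₈ := Exec.assign (x := 17)
    (safe_recordAddr hl hw (σ := σ₇) (u := .bin .shr (.var 11) (.bin .add (.var 8) (.lit 1)))
    (v := .var 16)
    (by simp only [Expr.Safe, BinOp.NoOverflow, Expr.eval, ← hi, and_true]; omega) (by simp [Expr.Safe])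
    (by simpa [Expr.eval, BinOp.natEval, g11, ← hi] using hnode (i + 1))
    (by simpa [Expr.eval, g16] using hv₂) (by simpa [Expr.eval, g16] using hv₁))
  rw [eval_recordAddr] at e₈
  simp only [Expr.eval, BinOp.natEval, g11, g16, ← hi] at e₈
  set e' := m (m v + A / 2 ^ (i + 1)) + 8 * v with he'
  set σ₈ := Function.update σ₇ 17 e' with hσ₈
  have k17 : σ₈ 17 = e' := by simp [hσ₈]
  have k11 : σ₈ 11 = A := by simp [hσ₈, g11]
  have k8 : σ₈ 8 = i := by simp [hσ₈, hi]
  have k18 : σ₈ 18 = m (e + 2) := by simp [hσ₈, g18]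
  have k20 : σ₈ 20 = sizeLog (cell L P (A / 2 ^ l) v) := by simp [hσ₈, g20]
  have hbit : A / 2 ^ i % 2 < 2 := Nat.mod_lt _ (by norm_num)
  have hcell' : (A / 2 ^ (i + 1), v) ∈ cells L P := not_not.1 hnq
  -- The bit tells whether the empty child is left or right, and so selects the stored rank of the
  -- matching end of the parent's range.
  have hrank₁ : m (e' + 2 + A / 2 ^ i % 2) = rankBelow L P v A := by
    rw [he', hl.rank _ _ hcell' _ hbit, nodeHeight_div hA₁ hA₂ (by omega)]
    refine (rankBelow_eq_of_cell_empty hA₁ hA₂ hC₁ hC₂ (by omega) hj.le fun h => ?_).symm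
    exact hq ((mem_cells hP hA₁ hA₂ hC₁ hC₂ (by omega) hj).2 h)
  have hrank₂ : m (e + 2) = rankBelow L P v (A / 2 ^ l * 2 ^ l) := by
    have := hl.rank _ _ hcell 0 (by norm_num)
    rwa [add_zero, add_zero, nodeHeight_div hA₁ hA₂ (by omega)] at this
  have hadd := rankBelow_eq_add (P := P) hA₁ hA₂ hC₁ hC₂ (i := l) (by omega) hj.le
  rw [← hv] at hadd
  have hJ : 2 ^ sizeLog (cell L P (A / 2 ^ l) v) ≤ S := by
    refine le_trans ?_ ((Nat.le_add_left _ _).trans (hl.table_le _ _ hcell))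
    exact (Nat.le_mul_of_pos_left _ two_pos).trans (Nat.le_mul_of_pos_right _ (Nat.two_pow_pos s))
  have hr : #((cell L P (A / 2 ^ l) v).filter (·.1 < A)) ≤ #(cell L P (A / 2 ^ l) v) :=
    card_filter_le _ _
  have hcard := card_lt_two_pow_sizeLog (cell L P (A / 2 ^ l) v)
  have e₉ := Exec.assign (w := w) (S := S) (m := m) (s := σ₈) (x := 18)
    (e := .bin .add (.bin .shl (.lit 1) (.var 20))
      (.bin .sub (.load (.bin .add (.bin .add (.var 17) (.lit 2))
        (.bin .and (.bin .shr (.var 11) (.var 8)) (.lit 1)))) (.var 18)))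
    (by
      simp only [Expr.Safe, Expr.eval, BinOp.NoOverflow, BinOp.natEval, k17, k11, k8, k18, k20,
        Nat.and_one_is_mod, hrank₁, hrank₂, and_true]
      omega)
  simp only [Expr.eval, BinOp.natEval, k17, k11, k8, k18, k20,
        Nat.and_one_is_mod, hrank₁, hrank₂] at e₉
  refine ⟨_, (e₁.seq (e₂.seq (e₃.seq (e₄.seq (e₅.seq (e₆.seq (e₇.seq (e₈.seq e₉)))))))).mono ?_,
    fun r hr => ?_, ?_, ?_, ?_, ?_⟩
  · simp only [Expr.len, recordAddr, missing]; omega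
  · simp only [hσ₈, show r ≠ 18 by omega, show r ≠ 17 by omega, ne_eq, not_false_eq_true,
      Function.update_of_ne]
    by_cases h : r = 8
    · omega
    · rw [hrest r (by omega) (by omega) (by omega), flow r hr]
  · simp [hσ₈, hrest, f13]
  · simp only [Function.update_self]
    omega
  · simp [hσ₈, hrest, f19]
  · simp [k20]

end Layout

end WordRAM

/-! ### Approximating a two-sided query in a cell -/

/-- The points that a query `(A, B] × (C, D]` has in the left subtrees below the split levels
`l` and `j`. -/
def lowerPart (P : Finset (ℕ × ℕ)) (A C l j : ℕ) : Finset (ℕ × ℕ) :=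
  P.filter fun p => (A < p.1 ∧ p.1 / 2 ^ l = A / 2 ^ l) ∧ C < p.2 ∧ p.2 / 2 ^ j = C / 2 ^ j

namespace WordRAM

/-- With the second coordinate of the query in register `13`, the position of its first coordinate
in `18`, the address of the table in `19` and its height in `20`, add the approximate answer to
register `7`. -/
def findCount (s : ℕ) : Cmd :=
  .seq (.assign 8 (.lit 0))
  (.seq (.assign 9 (.bin .shl (.var 20) (.lit s)))
  (.seq (bsearch (.var 13) (.load (.bin .add (.var 19) (.bin .add
      (.bin .shl (.bin .shr (.var 18) (.bin .shr (.var 10) (.lit s))) (.lit s))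
      (.bin .and (.var 10) (.lit (2 ^ s - 1)))))))
    (.assign 7 (.bin .add (.var 7) (.bin .sub (.bin .shl
      (.bin .add (.lit (2 ^ s)) (.bin .and (.var 8) (.lit (2 ^ s - 1))))
      (.bin .shr (.var 8) (.lit s))) (.lit (2 ^ s)))))))

section Layout

variable {L s w S : ℕ} {P : Finset (ℕ × ℕ)} {m : ℕ → ℕ}

/-- Count `0` is always reached and the top of the scale exceeds the size of the cell, so binary
search finds a place of change, although `Reached` may fail to be monotone because of the rounding.
-/
theorem exec_findCount (hl : Layout L s w P S m) (hw : 8 * S < 2 ^ w) (hs : 1 ≤ s)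
    {u v r C k : ℕ} (hC : C < 2 ^ (L + 1)) (hcell : (u, v) ∈ cells L P)
    (hr : r ≤ #(cell L P u v)) (hk : sizeLog (cell L P u v) * 2 ^ s ≤ 2 ^ k)
    {σ : ℕ → ℕ} (h7 : σ 7 + S < 2 ^ w) (h13 : σ 13 = C)
    (h18 : σ 18 = 2 ^ sizeLog (cell L P u v) + r)
    (h19 : σ 19 = m (m (m v + u) + 8 * v + 4)) (h20 : σ 20 = sizeLog (cell L P u v)) :
    ∃ σ' i, Exec w S m (findCount s) σ (100 * (k + 1)) σ' ∧ (∀ r < 7, σ' r = σ r) ∧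
      σ' 7 = σ 7 + scale s i ∧ scale s i ≤ S ∧ Reached s (cell L P u v) r C i ∧
      ¬ Reached s (cell L P u v) r C (i + 1) := by
  have hpos : 0 < 2 ^ w := by positivity
  set D := cell L P u v with hD
  have hJ : sizeLog D < 2 ^ sizeLog D := Nat.lt_two_pow_self
  have hJ₁ : 1 ≤ sizeLog D := Nat.le_add_left _ _
  have hs2 : s < 2 ^ s := Nat.lt_two_pow_self
  have hcard := card_lt_two_pow_sizeLog D
  have htab := hl.table_le u v hcell
  rw [← hD] at htab
  have hJS : 2 * (sizeLog D * 2 ^ s) ≤ S := by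
    have := Nat.mul_le_mul_right (2 ^ s) hJ.le
    nlinarith
  have hsS : 2 ^ s ≤ S := by
    have := Nat.mul_le_mul_right (2 ^ s) hJ₁
    omega
  have e₁ := Exec.assign (w := w) (S := S) (m := m) (s := σ) (x := 8) (e := .lit 0) hpos
  simp only [Expr.eval] at e₁
  set σ₁ := Function.update σ 8 0 with hσ₁
  have g20 : σ₁ 20 = sizeLog D := by simp [hσ₁, h20]
  have e₂ := Exec.assign (w := w) (S := S) (m := m) (s := σ₁) (x := 9)
    (e := .bin .shl (.var 20) (.lit s))
    (by simp only [Expr.Safe, Expr.eval, BinOp.NoOverflow, g20]; omega)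
  simp only [Expr.eval, BinOp.natEval, g20] at e₂
  set σ₂ := Function.update σ₁ 9 (sizeLog D * 2 ^ s) with hσ₂
  have f8 : σ₂ 8 = 0 := by simp [hσ₂, hσ₁]
  have f9 : σ₂ 9 = sizeLog D * 2 ^ s := by simp [hσ₂]
  obtain ⟨σ₃, e₃, -, hi, hq, hnq, hrest⟩ := exec_bsearch (w := w) (S := S) (m := m)
    (x := .var 13) (y := .load (.bin .add (.var 19) (.bin .add
      (.bin .shl (.bin .shr (.var 18) (.bin .shr (.var 10) (.lit s))) (.lit s))
      (.bin .and (.var 10) (.lit (2 ^ s - 1))))))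
    (Q := Reached s D r C) k (s := σ₂)
    (by rw [f8, f9]; positivity) (by omega) (by rw [f8]; exact reached_zero _ _ _ _)
    (by rw [f9]; exact not_reached_top hs _ _) (by omega)
    (fun i _ hi s' hs' hi' => by
      have g13 : s' 13 = C := by
        rw [hs' 13 (by omega) (by omega) (by omega)]; simp [hσ₂, hσ₁, h13]
      have g18 : s' 18 = 2 ^ sizeLog D + r := by
        rw [hs' 18 (by omega) (by omega) (by omega)]; simp [hσ₂, hσ₁, h18]
      have g19 : s' 19 = m (m (m v + u) + 8 * v + 4) := by
        rw [hs' 19 (by omega) (by omega) (by omega)]; simp [hσ₂, hσ₁, h19]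
      have hpos' : (2 ^ sizeLog D + r) / 2 ^ (i / 2 ^ s) < 2 * 2 ^ sizeLog D :=
        (Nat.div_le_self _ _).trans_lt (by omega)
      have hq : i % 2 ^ s < 2 ^ s := Nat.mod_lt _ (by positivity)
      have haddr : (2 ^ sizeLog D + r) / 2 ^ (i / 2 ^ s) * 2 ^ s + i % 2 ^ s <
          2 * 2 ^ sizeLog D * 2 ^ s := by
        calc (2 ^ sizeLog D + r) / 2 ^ (i / 2 ^ s) * 2 ^ s + i % 2 ^ s
            < ((2 ^ sizeLog D + r) / 2 ^ (i / 2 ^ s) + 1) * 2 ^ s := by rw [add_mul]; omega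
          _ ≤ _ := Nat.mul_le_mul_right _ hpos'
      refine ⟨by simp [Expr.Safe], ?_, ?_⟩
      · simp only [Expr.Safe, Expr.eval, BinOp.NoOverflow, BinOp.natEval, g18, g19, hi',
          Nat.and_two_pow_sub_one_eq_mod, and_true]
        omega
      · simp only [Expr.eval, BinOp.natEval, g13, g18, g19, hi', Nat.and_two_pow_sub_one_eq_mod]
        rw [hl.table u v hcell _ hpos' _ hq]
        exact lt_tableEntry_iff hr (hi.trans_eq f9) hC)
  set i := σ₃ 8 with hi'
  have g7 : σ₃ 7 = σ 7 := by
    rw [hrest 7 (by omega) (by omega) (by omega)]; simp [hσ₂, hσ₁]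
  have hscale := scale_add s i
  have hmod : i % 2 ^ s < 2 ^ s := Nat.mod_lt _ (by positivity)
  have hscale' : (2 ^ s + i % 2 ^ s) * 2 ^ (i / 2 ^ s) ≤ S := by
    refine le_trans ?_ ((Nat.le_add_left _ _).trans htab)
    have hj : i / 2 ^ s ≤ sizeLog D := (Nat.div_lt_of_lt_mul (by rw [mul_comm]; omega)).le
    calc _ ≤ (2 * 2 ^ s) * 2 ^ sizeLog D :=
          Nat.mul_le_mul (by omega) (Nat.pow_le_pow_right (by norm_num) hj)
      _ = _ := by ring
  have e₄ := Exec.assign (w := w) (S := S) (m := m) (s := σ₃) (x := 7)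
    (e := .bin .add (.var 7) (.bin .sub (.bin .shl
      (.bin .add (.lit (2 ^ s)) (.bin .and (.var 8) (.lit (2 ^ s - 1))))
      (.bin .shr (.var 8) (.lit s))) (.lit (2 ^ s))))
    (by
      simp only [Expr.Safe, Expr.eval, BinOp.NoOverflow, BinOp.natEval, g7, ← hi',
        Nat.and_two_pow_sub_one_eq_mod, and_true]
      omega)
  simp only [Expr.eval, BinOp.natEval, g7, ← hi', Nat.and_two_pow_sub_one_eq_mod] at e₄
  refine ⟨_, i, (e₁.seq (e₂.seq (e₃.seq e₄))).mono ?_, fun r hr => ?_, ?_, ?_, hq, hnq⟩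
  · simp only [Expr.len]; omega
  · rw [Function.update_of_ne (by omega), hrest r (by omega) (by omega) (by omega)]
    simp [hσ₂, hσ₁, show r ≠ 8 by omega, show r ≠ 9 by omega]
  · simp only [Function.update_self]; omega
  · omega

/-- Add the approximate size of the lower part of the query to register `7`. -/
def countLowerPart (s : ℕ) : Cmd :=
  .seq (.assign 11 (.bin .add (.var 6) (.var 0)))
  (.seq (.assign 12 (.bin .add (.var 6) (.var 1)))
  (.seq (.assign 13 (.bin .add (.var 5) (.var 2)))
  (.seq (.assign 14 (.bin .add (.var 5) (.var 3)))
  (.seq (findSplit 11 12)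
  (.seq (.assign 15 (.var 8))
  (.seq (findSplit 13 14)
  (.seq (.assign 16 (.bin .shr (.var 13) (.var 8)))
    (.ifLt (.lit 0) (missing (.bin .shr (.var 11) (.var 15)) (.var 16)) .skip
      (.seq findRank (findCount s))))))))))

theorem exec_countLowerPart (hP : AreLeaves L P) (hl : Layout L s w P S m) (hw : 8 * S < 2 ^ w)
    (hs : 2 ≤ s) {A B C D k : ℕ} (hA₁ : 2 ^ (L + 2) ≤ A) (hA₂ : A < 2 ^ (L + 3))
    (hB₂ : B < 2 ^ (L + 3)) (hC₁ : 2 ^ L ≤ C) (hC₂ : C < 2 ^ (L + 1)) (hD₂ : D < 2 ^ (L + 1))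
    (hAB : A / 2 ≠ B / 2) (hAB' : A / 2 ^ L = B / 2 ^ L) (hCD : C ≠ D)
    (hCD' : C / 2 ^ L = D / 2 ^ L) (hAP : ∀ p ∈ P, p.1 ≠ A) (hk : L ≤ 2 ^ k)
    (hk' : ∀ u v, sizeLog (cell L P u v) * 2 ^ s ≤ 2 ^ k) {σ : ℕ → ℕ} (h4 : σ 4 = L)
    (hA : σ 6 + σ 0 = A) (hB : σ 6 + σ 1 = B) (hC : σ 5 + σ 2 = C) (hD : σ 5 + σ 3 = D)
    (h7 : σ 7 + S < 2 ^ w) :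
    ∃ σ' l j τ, Exec w S m (countLowerPart s) σ (600 * (k + 1)) σ' ∧ (∀ r < 7, σ' r = σ r) ∧
      σ' 7 = σ 7 + τ ∧ τ ≤ S ∧ (l < L ∧ SplitLevel A B l) ∧ (j < L ∧ SplitLevel C D j) ∧
      2 ^ s * τ ≤ (2 ^ s + 4) * #(lowerPart P A C l j) ∧
      2 ^ s * #(lowerPart P A C l j) ≤ 2 ^ s * τ + 4 * #(lowerPart P A C l j) := by
  have hpos : 0 < 2 ^ w := by positivity
  have hLS : 26 * 2 ^ L ≤ S := hl.leaves_le
  have hLW : L < 2 ^ L := Nat.lt_two_pow_self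
  have hW₁ : 2 ^ (L + 1) = 2 * 2 ^ L := by ring
  have hW₃ : 2 ^ (L + 3) = 8 * 2 ^ L := by ring
  have e₁ := Exec.assign (w := w) (S := S) (m := m) (s := σ) (x := 11)
    (e := .bin .add (.var 6) (.var 0))
    (by simp only [Expr.Safe, Expr.eval, BinOp.NoOverflow]; omega)
  simp only [Expr.eval, BinOp.natEval, hA] at e₁
  set σ₁ := Function.update σ 11 A with hσ₁
  have hB₁ : σ₁ 6 + σ₁ 1 = B := by simpa [hσ₁] using hB
  have e₂ := Exec.assign (w := w) (S := S) (m := m) (s := σ₁) (x := 12)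
    (e := .bin .add (.var 6) (.var 1))
    (by simp only [Expr.Safe, Expr.eval, BinOp.NoOverflow]; omega)
  simp only [Expr.eval, BinOp.natEval, hB₁] at e₂
  set σ₂ := Function.update σ₁ 12 B with hσ₂
  have hC₃ : σ₂ 5 + σ₂ 2 = C := by simpa [hσ₂, hσ₁] using hC
  have e₃ := Exec.assign (w := w) (S := S) (m := m) (s := σ₂) (x := 13)
    (e := .bin .add (.var 5) (.var 2))
    (by simp only [Expr.Safe, Expr.eval, BinOp.NoOverflow]; omega)
  simp only [Expr.eval, BinOp.natEval, hC₃] at e₃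
  set σ₃ := Function.update σ₂ 13 C with hσ₃
  have hD₃ : σ₃ 5 + σ₃ 3 = D := by simpa [hσ₃, hσ₂, hσ₁] using hD
  have e₄ := Exec.assign (w := w) (S := S) (m := m) (s := σ₃) (x := 14)
    (e := .bin .add (.var 5) (.var 3))
    (by simp only [Expr.Safe, Expr.eval, BinOp.NoOverflow]; omega)
  simp only [Expr.eval, BinOp.natEval, hD₃] at e₄
  set σ₄ := Function.update σ₃ 14 D with hσ₄
  have f11 : σ₄ 11 = A := by simp [hσ₄, hσ₃, hσ₂, hσ₁]
  have f12 : σ₄ 12 = B := by simp [hσ₄, hσ₃, hσ₂]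
  have f13 : σ₄ 13 = C := by simp [hσ₄, hσ₃]
  have f14 : σ₄ 14 = D := by simp [hσ₄]
  have f4 : σ₄ 4 = L := by simp [hσ₄, hσ₃, hσ₂, hσ₁, h4]
  have flow : ∀ r < 8, σ₄ r = σ r := fun r hr => by
    simp [hσ₄, hσ₃, hσ₂, hσ₁, show r ≠ 11 by omega, show r ≠ 12 by omega,
      show r ≠ 13 by omega, show r ≠ 14 by omega]
  have hne : A ≠ B := fun h => hAB (by rw [h])
  obtain ⟨σ₅, e₅, hl₅, hsplit, hrest⟩ := exec_findSplit (w := w) (S := S) (m := m) (s := σ₄)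
    (x := 11) (y := 12) (k := k) (by norm_num) (by norm_num) (by norm_num) (by norm_num)
    (by rwa [f11, f12]) (by rwa [f11, f12, f4]) (by rwa [f4]) (by omega)
  rw [f11, f12] at hsplit
  rw [f4] at hl₅
  set l := σ₅ 8 with hl'
  -- `A` and `B` have different parents, so the split is not at the leaves; the rank search needs `0
  -- < l` to have distinct ends.
  have hl₀ : 0 < l := by
    rcases Nat.eq_zero_or_pos l with h | h
    · rw [h] at hsplit
      exact absurd (by simpa using hsplit.2) hAB
    · exact h
  have e₆ := Exec.assign (w := w) (S := S) (m := m) (s := σ₅) (x := 15) (e := .var 8)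
    (by simp [Expr.Safe])
  simp only [Expr.eval, ← hl'] at e₆
  set σ₆ := Function.update σ₅ 15 l with hσ₆
  have i13 : σ₆ 13 = C := by simp [hσ₆, hrest, f13]
  have i14 : σ₆ 14 = D := by simp [hσ₆, hrest, f14]
  have i4 : σ₆ 4 = L := by simp [hσ₆, hrest, f4]
  obtain ⟨σ₇, e₇, hj₇, hsplit', hrest'⟩ := exec_findSplit (w := w) (S := S) (m := m) (s := σ₆)
    (x := 13) (y := 14) (k := k) (by norm_num) (by norm_num) (by norm_num) (by norm_num)
    (by rwa [i13, i14]) (by rwa [i13, i14, i4]) (by rwa [i4]) (by omega)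
  rw [i13, i14] at hsplit'
  rw [i4] at hj₇
  set j := σ₇ 8 with hj'
  have j13 : σ₇ 13 = C := by simp [hrest', i13]
  have e₈ := Exec.assign (w := w) (S := S) (m := m) (s := σ₇) (x := 16)
    (e := .bin .shr (.var 13) (.var 8)) (by simp [Expr.Safe, BinOp.NoOverflow])
  simp only [Expr.eval, BinOp.natEval, ← hj', j13] at e₈
  set σ₈ := Function.update σ₇ 16 (C / 2 ^ j) with hσ₈
  have k11 : σ₈ 11 = A := by simp [hσ₈, hrest', hσ₆, hrest, f11]
  have k13 : σ₈ 13 = C := by simp [hσ₈, j13]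
  have k15 : σ₈ 15 = l := by simp [hσ₈, hrest', hσ₆]
  have k16 : σ₈ 16 = C / 2 ^ j := by simp [hσ₈]
  have klow : ∀ r < 8, σ₈ r = σ r := fun r hr => by
    rw [hσ₈, Function.update_of_ne (by omega), hrest' r (by omega) (by omega) (by omega), hσ₆,
      Function.update_of_ne (by omega), hrest r (by omega) (by omega) (by omega), flow r hr]
  have hu₁ : 1 ≤ A / 2 ^ l :=
    Nat.div_pos ((Nat.pow_le_pow_right (by norm_num) (by omega)).trans hA₁) (by positivity)
  have hv₁ : 1 ≤ C / 2 ^ j :=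
    Nat.div_pos ((Nat.pow_le_pow_right (by norm_num) (by omega)).trans hC₁) (by positivity)
  have hu₂ : A / 2 ^ l < 2 ^ (L + 3) := (Nat.div_le_self _ _).trans_lt hA₂
  have hv₂ : C / 2 ^ j < 2 ^ (L + 1) := (Nat.div_le_self _ _).trans_lt hC₂
  have hE : (Expr.bin .shr (.var 11) (.var 15)).eval m σ₈ = A / 2 ^ l := by
    simp [Expr.eval, BinOp.natEval, k11, k15]
  have hE' : (Expr.var 16).eval m σ₈ = C / 2 ^ j := k16
  have hsafe := safe_missing hl hw (σ := σ₈) (u := .bin .shr (.var 11) (.var 15)) (v := .var 16)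
    (by simp [Expr.Safe, BinOp.NoOverflow]) (by simp [Expr.Safe]) (by rwa [hE]) (by rwa [hE'])
    (by rwa [hE'])
  have heval := eval_missing hl (σ := σ₈) (u := .bin .shr (.var 11) (.var 15)) (v := .var 16)
    (by rwa [hE]) (by rwa [hE']) (by rwa [hE']) (by rwa [hE])
  rw [hE, hE'] at heval
  -- Strict and weak inequality agree at `A`, which is not the first coordinate of any point.
  have hpart : lowerPart P A C l j =
      (cell L P (A / 2 ^ l) (C / 2 ^ j)).filter fun p => A ≤ p.1 ∧ C < p.2 := by
    ext p
    simp only [lowerPart, mem_filter, mem_cell hA₁ hA₂ hC₁ hC₂ hl₅.le hj₇.le]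
    constructor
    · rintro ⟨hp, ⟨h₁, h₂⟩, h₃, h₄⟩
      exact ⟨⟨hp, h₂, h₄⟩, h₁.le, h₃⟩
    · rintro ⟨⟨hp, h₂, h₄⟩, h₁, h₃⟩
      exact ⟨hp, ⟨lt_of_le_of_ne h₁ (hAP p hp).symm, h₂⟩, h₃, h₄⟩
  by_cases hcell : (A / 2 ^ l, C / 2 ^ j) ∈ cells L P
  · obtain ⟨σ₉, e₉, hlow₉, h13, h18, h19, h20⟩ := exec_findRank hP hl hw hA₁ hA₂ hC₁ hC₂ hl₀ hl₅
      hj₇ hk hAP hcell k11 k15 k16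
    obtain ⟨τ', i, e₁₀, hlow, h7', hτ, hreach, hnreach⟩ := exec_findCount hl hw (by omega) hC₂ hcell
      (card_filter_le _ _) (hk' _ _) (σ := σ₉) (by rw [hlow₉ 7 (by omega), klow 7 (by omega)]; exact h7)
      (h13.trans k13) h18 h19 h20
    have e₁₁ := Exec.ifLt_false (c₁ := .skip) (x := .lit 0) hpos hsafe
      (by rw [show (Expr.lit 0).eval m σ₈ = 0 from rfl, heval]; exact not_not.2 hcell)
      (e₉.seq e₁₀)
    obtain ⟨h₁, h₂⟩ := scale_approx hs hreach hnreach
    refine ⟨_, l, j, scale s i,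
      (e₁.seq (e₂.seq (e₃.seq (e₄.seq (e₅.seq (e₆.seq (e₇.seq (e₈.seq e₁₁)))))))).mono ?_,
      fun r hr => ?_, ?_, hτ, ⟨hl₅, hsplit⟩, ⟨hj₇, hsplit'⟩, ?_⟩
    · simp only [Expr.len, recordAddr, missing]; omega
    · rw [hlow r hr, hlow₉ r (by omega), klow r (by omega)]
    · rw [h7', hlow₉ 7 (by omega), klow 7 (by omega)]
    · rw [hpart]
      exact ⟨h₁, h₂⟩
  · have e₁₁ := Exec.ifLt_true (c₂ := .seq findRank (findCount s)) (x := .lit 0) hpos hsafe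
      (by rw [show (Expr.lit 0).eval m σ₈ = 0 from rfl, heval]; exact hcell)
      (Exec.skip σ₈)
    have hempty : #(lowerPart P A C l j) = 0 := by
      rw [mem_cells hP hA₁ hA₂ hC₁ hC₂ hl₅ hj₇, not_nonempty_iff_eq_empty] at hcell
      rw [hpart, hcell]
      rfl
    refine ⟨_, l, j, 0,
      (e₁.seq (e₂.seq (e₃.seq (e₄.seq (e₅.seq (e₆.seq (e₇.seq (e₈.seq e₁₁)))))))).mono ?_,
      fun r hr => klow r (by omega), klow 7 (by omega), Nat.zero_le _, ⟨hl₅, hsplit⟩,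
      ⟨hj₇, hsplit'⟩, ?_⟩
    · simp only [Expr.len, recordAddr, missing]; omega
    · simp [hempty]

end Layout

end WordRAM

/-! ### Reduction of rectangles by quarter turns -/

/-- The quarter turn of the square of side `W`. -/
def turn (W : ℕ) (p : ℕ × ℕ) : ℕ × ℕ := (p.2, W - 1 - p.1)

/-- The point `p`, refined to residues `1` modulo `4`, after `t` quarter turns. -/
def turnedPoint (W t : ℕ) (p : ℕ × ℕ) : ℕ × ℕ := (turn W)^[t] (4 * p.1 + 1, 4 * p.2 + 1)

theorem turnedPoint_succ (W t : ℕ) (p : ℕ × ℕ) :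
    turnedPoint W (t + 1) p = turn W (turnedPoint W t p) :=
  Function.iterate_succ_apply' _ _ _

/-- Four copies of a set of points, one for each quarter turn, side by side at the leaves of the
trees. -/
def copies (L : ℕ) (P : Finset (ℕ × ℕ)) : Finset (ℕ × ℕ) :=
  (P ×ˢ range 4).image fun q => ((4 + q.2) * 2 ^ L + (turnedPoint (2 ^ L) q.2 q.1).1,
    2 ^ L + (turnedPoint (2 ^ L) q.2 q.1).2)

/-- `x` is to the right of `a` and below the same node of height `l`. -/
def InLower (a l x : ℕ) : Prop := a < x ∧ x / 2 ^ l = a / 2 ^ l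

instance (a l x : ℕ) : Decidable (InLower a l x) := inferInstanceAs (Decidable (_ ∧ _))

theorem shift_div (t x : ℕ) {i L : ℕ} (h : i ≤ L) :
    (t * 2 ^ L + x) / 2 ^ i = t * 2 ^ (L - i) + x / 2 ^ i := by
  have : t * 2 ^ L = t * 2 ^ (L - i) * 2 ^ i := by
    rw [mul_assoc, ← pow_add, Nat.sub_add_cancel h]
  rw [this, add_comm, Nat.add_mul_div_right _ _ (by positivity), add_comm]

/-- Subtracting from `2 ^ L - 1` complements all bits, so it commutes with dropping the last `i` of
them. -/
theorem complement_div {x i L : ℕ} (h : i ≤ L) (hx : x < 2 ^ L) :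
    (2 ^ L - 1 - x) / 2 ^ i = 2 ^ (L - i) - 1 - x / 2 ^ i := by
  have hpos : 0 < 2 ^ i := by positivity
  have hW : 2 ^ L = 2 ^ (L - i) * 2 ^ i := by rw [← pow_add, Nat.sub_add_cancel h]
  have hlt : x / 2 ^ i < 2 ^ (L - i) := Nat.div_lt_of_lt_mul (by rwa [mul_comm, ← hW])
  have hdm := Nat.div_add_mod' x (2 ^ i)
  have hmod := Nat.mod_lt x hpos
  obtain ⟨y, hy⟩ := Nat.exists_eq_add_of_lt hlt
  have e : 2 ^ L - 1 - x = (2 ^ i - 1 - x % 2 ^ i) + y * 2 ^ i := by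
    rw [hW, hy, add_mul, add_mul]
    omega
  rw [e, Nat.add_mul_div_right _ _ hpos, Nat.div_eq_of_lt (by omega)]
  omega

theorem complement_div_eq_iff {x y i L : ℕ} (h : i ≤ L) (hx : x < 2 ^ L) (hy : y < 2 ^ L) :
    (2 ^ L - 1 - x) / 2 ^ i = (2 ^ L - 1 - y) / 2 ^ i ↔ x / 2 ^ i = y / 2 ^ i := by
  have hW : 2 ^ L = 2 ^ i * 2 ^ (L - i) := by rw [← pow_add, Nat.add_sub_cancel' h]
  have h₁ : x / 2 ^ i < 2 ^ (L - i) := Nat.div_lt_of_lt_mul (by rwa [← hW])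
  have h₂ : y / 2 ^ i < 2 ^ (L - i) := Nat.div_lt_of_lt_mul (by rwa [← hW])
  rw [complement_div h hx, complement_div h hy]
  omega

/-- Ancestors that agree at height `l + 1` agree at every greater height. -/
theorem SplitLevel.unique {a b l l' : ℕ} (h : SplitLevel a b l) (h' : SplitLevel a b l') :
    l = l' := by
  have key : ∀ {l l'}, SplitLevel a b l → SplitLevel a b l' → ¬ l < l' := by
    intro l l' h h' hlt
    obtain ⟨z, rfl⟩ := Nat.exists_eq_add_of_le (Nat.succ_le_of_lt hlt)
    apply h'.1
    rw [Nat.succ_eq_add_one, pow_add, ← Nat.div_div_eq_div_mul, ← Nat.div_div_eq_div_mul, h.2]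
  have := key h h'
  have := key h' h
  omega

theorem SplitLevel.of_shift {t a b l L : ℕ} (hl : l < L)
    (h : SplitLevel (t * 2 ^ L + a) (t * 2 ^ L + b) l) : SplitLevel a b l := by
  obtain ⟨h₁, h₂⟩ := h
  rw [shift_div _ _ hl.le, shift_div _ _ hl.le] at h₁
  rw [shift_div _ _ (by omega), shift_div _ _ (by omega)] at h₂
  exact ⟨by omega, by omega⟩

theorem SplitLevel.of_complement {a b l L : ℕ} (hl : l < L) (ha : a < 2 ^ L) (hb : b < 2 ^ L)
    (h : SplitLevel (2 ^ L - 1 - b) (2 ^ L - 1 - a) l) : SplitLevel a b l := by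
  obtain ⟨h₁, h₂⟩ := h
  rw [ne_eq, complement_div_eq_iff hl.le hb ha] at h₁
  rw [complement_div_eq_iff (by omega) hb ha] at h₂
  exact ⟨fun h => h₁ h.symm, h₂.symm⟩

/-- An interval is the disjoint union of a lower and a (reflected) lower part. -/
theorem inLower_or {a b l x L : ℕ} (hl : l < L) (hb : b < 2 ^ L)
    (hx : x < 2 ^ L) (hab : a < b) (h : SplitLevel a b l) :
    (a < x ∧ x < b ↔ InLower a l x ∨ InLower (2 ^ L - 1 - b) l (2 ^ L - 1 - x)) ∧
      ¬ (InLower a l x ∧ InLower (2 ^ L - 1 - b) l (2 ^ L - 1 - x)) := by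
  have e : 2 ^ L - 1 - b < 2 ^ L - 1 - x ↔ x < b := by omega
  simp only [InLower, complement_div_eq_iff hl.le hx hb, e]
  obtain ⟨h₁, h₂⟩ := h
  have hpos : 0 < 2 ^ l := by positivity
  simp only [pow_succ, ← Nat.div_div_eq_div_mul] at h₂
  have hle : a / 2 ^ l ≤ b / 2 ^ l := Nat.div_le_div_right hab.le
  refine ⟨⟨fun ⟨hx₁, hx₂⟩ => ?_, ?_⟩, by omega⟩
  · have := Nat.div_le_div_right (c := 2 ^ l) hx₁.le
    have := Nat.div_le_div_right (c := 2 ^ l) hx₂.le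
    omega
  · have lt_of : ∀ {y z : ℕ}, y / 2 ^ l < z / 2 ^ l → y < z := fun hyz =>
      lt_of_not_ge fun hge => hyz.not_ge (Nat.div_le_div_right hge)
    rintro (⟨hx₁, hx₂⟩ | ⟨hx₁, hx₂⟩)
    · exact ⟨hx₁, lt_of (by omega)⟩
    · exact ⟨lt_of (by omega), hx₁⟩

/-- As `4` divides `2 ^ L`, reflection exchanges the residues `1` and `2`, and also `0` and `3`.
Turned points therefore never meet turned query bounds. -/
theorem turnedPoint_bounds {L : ℕ} (hL : 2 ≤ L) {p : ℕ × ℕ} (h₁ : 4 * p.1 + 1 < 2 ^ L)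
    (h₂ : 4 * p.2 + 1 < 2 ^ L) (t : ℕ) :
    ((turnedPoint (2 ^ L) t p).1 < 2 ^ L ∧ (turnedPoint (2 ^ L) t p).1 % 4 ≠ 0 ∧
      (turnedPoint (2 ^ L) t p).1 % 4 ≠ 3) ∧
    ((turnedPoint (2 ^ L) t p).2 < 2 ^ L ∧ (turnedPoint (2 ^ L) t p).2 % 4 ≠ 0 ∧
      (turnedPoint (2 ^ L) t p).2 % 4 ≠ 3) := by
  have hdvd : 2 ^ L % 4 = 0 := Nat.mod_eq_zero_of_dvd (pow_dvd_pow 2 hL)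
  induction t with
  | zero => simp only [turnedPoint, Function.iterate_zero, id]; omega
  | succ t ih =>
    rw [turnedPoint_succ, turn]
    omega

theorem turnedPoint_injOn {L : ℕ} (hL : 2 ≤ L) {p p' : ℕ × ℕ} (h₁ : 4 * p.1 + 1 < 2 ^ L)
    (h₂ : 4 * p.2 + 1 < 2 ^ L) (h₁' : 4 * p'.1 + 1 < 2 ^ L) (h₂' : 4 * p'.2 + 1 < 2 ^ L) (t : ℕ)
    (h : turnedPoint (2 ^ L) t p = turnedPoint (2 ^ L) t p') : p = p' := by
  induction t with
  | zero =>
    simp only [turnedPoint, Function.iterate_zero, id, Prod.mk.injEq] at h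
    exact Prod.ext (by omega) (by omega)
  | succ t ih =>
    have b := turnedPoint_bounds hL h₁ h₂ t
    have b' := turnedPoint_bounds hL h₁' h₂' t
    rw [turnedPoint_succ, turnedPoint_succ, turn, turn, Prod.mk.injEq] at h
    exact ih (Prod.ext (by omega) (by omega))

section Copies

variable {L : ℕ} {P : Finset (ℕ × ℕ)}

theorem card_copies_le : #(copies L P) ≤ 4 * #P :=
  card_image_le.trans (by simp [mul_comm])

theorem areLeaves_copies (hL : 2 ≤ L)
    (hP : ∀ p ∈ P, 4 * p.1 + 1 < 2 ^ L ∧ 4 * p.2 + 1 < 2 ^ L) : AreLeaves L (copies L P) := by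
  intro p hp
  obtain ⟨⟨q, t⟩, hq, rfl⟩ := mem_image.1 hp
  simp only [mem_product, mem_range] at hq
  have hb := turnedPoint_bounds hL (hP q hq.1).1 (hP q hq.1).2 t
  have h₁ : 2 ^ (L + 1) = 2 * 2 ^ L := by ring
  have h₂ : 2 ^ (L + 2) = 4 * 2 ^ L := by ring
  have h₃ : 2 ^ (L + 3) = 8 * 2 ^ L := by ring
  have h₄ : (4 + t) * 2 ^ L = 4 * 2 ^ L + t * 2 ^ L := by ring
  have h₅ : t * 2 ^ L ≤ 3 * 2 ^ L := Nat.mul_le_mul_right _ (by omega)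
  simp only
  omega

theorem ne_of_mem_copies (hL : 2 ≤ L)
    (hP : ∀ p ∈ P, 4 * p.1 + 1 < 2 ^ L ∧ 4 * p.2 + 1 < 2 ^ L) {t a : ℕ} (ha : a % 4 = 0) :
    ∀ p ∈ copies L P, p.1 ≠ t * 2 ^ L + a := by
  intro p hp
  obtain ⟨⟨q, t'⟩, hq, rfl⟩ := mem_image.1 hp
  simp only [mem_product, mem_range] at hq
  have hb := turnedPoint_bounds hL (hP q hq.1).1 (hP q hq.1).2 t'
  obtain ⟨z, hz⟩ : 4 ∣ 2 ^ L := pow_dvd_pow 2 hL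
  have h₁ : t * 2 ^ L = 4 * (t * z) := by rw [hz]; ring
  have h₂ : (4 + t') * 2 ^ L = 4 * ((4 + t') * z) := by rw [hz]; ring
  simp only [h₁, h₂]
  omega

/-- A node of height at most `L` lies inside the block of a single copy, so the other copies
contribute nothing. -/
theorem card_lowerPart_copies (hL : 2 ≤ L)
    (hP : ∀ p ∈ P, 4 * p.1 + 1 < 2 ^ L ∧ 4 * p.2 + 1 < 2 ^ L) {t a c l j : ℕ} (ht : t < 4)
    (ha : a < 2 ^ L) (hl : l ≤ L) (hj : j ≤ L) :
    #(lowerPart (copies L P) ((4 + t) * 2 ^ L + a) (2 ^ L + c) l j) =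
      #(P.filter fun p => InLower a l (turnedPoint (2 ^ L) t p).1 ∧
        InLower c j (turnedPoint (2 ^ L) t p).2) := by
  have hy : ∀ y, (2 ^ L + y) / 2 ^ j = (2 ^ L + c) / 2 ^ j ↔ y / 2 ^ j = c / 2 ^ j := by
    intro y
    have h₁ := shift_div 1 y hj
    have h₂ := shift_div 1 c hj
    rw [one_mul] at h₁ h₂
    omega
  symm
  refine card_bij (fun p _ => ((4 + t) * 2 ^ L + (turnedPoint (2 ^ L) t p).1,
    2 ^ L + (turnedPoint (2 ^ L) t p).2)) ?_ ?_ ?_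
  · intro p hp
    obtain ⟨hp, h₁, h₂⟩ := mem_filter.1 hp
    refine mem_filter.2 ⟨mem_image.2 ⟨(p, t), by simp [hp, ht], rfl⟩, ⟨?_, ?_⟩, ?_, ?_⟩
    · have := h₁.1; simp only; omega
    · rw [shift_div _ _ hl, shift_div _ _ hl, h₁.2]
    · have := h₂.1; simp only; omega
    · exact (hy _).2 h₂.2
  · intro p hp p' hp' he
    obtain ⟨h₁, h₂⟩ := hP p (mem_filter.1 hp).1
    obtain ⟨h₁', h₂'⟩ := hP p' (mem_filter.1 hp').1
    rw [Prod.mk.injEq] at he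
    exact turnedPoint_injOn hL h₁ h₂ h₁' h₂' t (Prod.ext (by omega) (by omega))
  · intro q hq
    obtain ⟨hq, ⟨h₁, h₂⟩, h₃, h₄⟩ := mem_filter.1 hq
    obtain ⟨⟨p, t'⟩, hp, rfl⟩ := mem_image.1 hq
    simp only [mem_product, mem_range] at hp h₁ h₂ h₃ h₄
    have hb := turnedPoint_bounds hL (hP p hp.1).1 (hP p hp.1).2 t'
    -- Equal ancestors at height `l` remain equal at height `L`, where they are `4 + t'` and `4 +
    -- t`.
    have htt : t' = t := by
      have h₅ := congrArg (· / 2 ^ (L - l)) h₂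
      simp only [Nat.div_div_eq_div_mul, ← pow_add, Nat.add_sub_cancel' hl] at h₅
      rw [shift_div _ _ le_rfl, shift_div _ _ le_rfl, Nat.div_eq_of_lt hb.1.1,
        Nat.div_eq_of_lt ha] at h₅
      simp at h₅
      exact h₅
    subst htt
    rw [shift_div _ _ hl, shift_div _ _ hl] at h₂
    exact ⟨p, mem_filter.2 ⟨hp.1, ⟨by omega, by omega⟩, by omega, (hy _).1 h₄⟩, rfl⟩

/-- A query rectangle is the disjoint union of the lower parts after the four quarter turns. -/
theorem rangeCount_eq_sum
    (hP : ∀ p ∈ P, 4 * p.1 + 1 < 2 ^ L ∧ 4 * p.2 + 1 < 2 ^ L) {a b c d l j : ℕ}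
    (hab : a ≤ b) (hcd : c ≤ d) (hb : 4 * b + 3 < 2 ^ L) (hd : 4 * d + 3 < 2 ^ L)
    (hl : l < L) (hj : j < L) (hsl : SplitLevel (4 * a) (4 * b + 3) l)
    (hsj : SplitLevel (4 * c) (4 * d + 3) j) :
    rangeCount P a b c d =
      #(P.filter fun p => InLower (4 * a) l (turnedPoint (2 ^ L) 0 p).1 ∧
        InLower (4 * c) j (turnedPoint (2 ^ L) 0 p).2) +
      #(P.filter fun p => InLower (4 * c) j (turnedPoint (2 ^ L) 1 p).1 ∧
        InLower (2 ^ L - 1 - (4 * b + 3)) l (turnedPoint (2 ^ L) 1 p).2) +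
      #(P.filter fun p => InLower (2 ^ L - 1 - (4 * b + 3)) l (turnedPoint (2 ^ L) 2 p).1 ∧
        InLower (2 ^ L - 1 - (4 * d + 3)) j (turnedPoint (2 ^ L) 2 p).2) +
      #(P.filter fun p => InLower (2 ^ L - 1 - (4 * d + 3)) j (turnedPoint (2 ^ L) 3 p).1 ∧
        InLower (4 * a) l (turnedPoint (2 ^ L) 3 p).2) := by
  have hr : rangeCount P a b c d =
      #(P.filter fun p => (4 * a < 4 * p.1 + 1 ∧ 4 * p.1 + 1 < 4 * b + 3) ∧
        (4 * c < 4 * p.2 + 1 ∧ 4 * p.2 + 1 < 4 * d + 3)) := by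
    unfold rangeCount
    congr 1
    ext p
    simp only [mem_inter, mem_product, mem_Icc, mem_filter]
    refine and_congr_right fun _ => ?_
    omega
  rw [hr]
  simp only [card_filter, ← sum_add_distrib]
  refine sum_congr rfl fun p hp => ?_
  obtain ⟨h₁, h₂⟩ := hP p hp
  obtain ⟨hx, hx'⟩ := inLower_or hl hb h₁ (by omega) hsl
  obtain ⟨hy, hy'⟩ := inLower_or hj hd h₂ (by omega) hsj
  have e₃ : 2 ^ L - 1 - (2 ^ L - 1 - (4 * p.1 + 1)) = 4 * p.1 + 1 := by omega
  simp only [turnedPoint, Function.iterate_succ, Function.iterate_zero, Function.comp, id, turn,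
    hx, hy, e₃]
  -- In each coordinate, a point of the query is in exactly one of the two halves, so exactly one of
  -- the four products contains it.
  by_cases c₁ : InLower (4 * a) l (4 * p.1 + 1) <;>
  by_cases c₂ : InLower (2 ^ L - 1 - (4 * b + 3)) l (2 ^ L - 1 - (4 * p.1 + 1)) <;>
  by_cases c₃ : InLower (4 * c) j (4 * p.2 + 1) <;>
  by_cases c₄ : InLower (2 ^ L - 1 - (4 * d + 3)) j (2 ^ L - 1 - (4 * p.2 + 1)) <;>
  simp_all

end Copies

/-! ### The query program -/

namespace WordRAM

/-- Turn the query, given by its bounds in registers `0, …, 3`, by a quarter. -/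
def turnQuery : Cmd :=
  .seq (.assign 8 (.var 0))
  (.seq (.assign 9 (.var 1))
  (.seq (.assign 0 (.var 2))
  (.seq (.assign 1 (.var 3))
  (.seq (.assign 2 (.bin .sub (.bin .sub (.var 5) (.lit 1)) (.var 9)))
  (.seq (.assign 3 (.bin .sub (.bin .sub (.var 5) (.lit 1)) (.var 8)))
    (.assign 6 (.bin .add (.var 6) (.var 5))))))))

/-- The bounds of a query that was refined to residues `0` and `3` modulo `4`. -/
def Bounds (W a b : ℕ) : Prop := a < b ∧ b < W ∧ a % 4 = 0 ∧ b % 4 = 3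

theorem Bounds.complement {L a b : ℕ} (hL : 2 ≤ L) (h : Bounds (2 ^ L) a b) :
    Bounds (2 ^ L) (2 ^ L - 1 - b) (2 ^ L - 1 - a) := by
  have hdvd : 2 ^ L % 4 = 0 := Nat.mod_eq_zero_of_dvd (pow_dvd_pow 2 hL)
  unfold Bounds at *
  omega

/-- The variables between two quarter turns: the query is `(a, b, c, d)`, there were `t` turns,
and the sum of the counts so far is `T`. -/
def TurnState (L : ℕ) (σ : ℕ → ℕ) (a b c d t T : ℕ) : Prop :=
  σ 0 = a ∧ σ 1 = b ∧ σ 2 = c ∧ σ 3 = d ∧ σ 4 = L ∧ σ 5 = 2 ^ L ∧ σ 6 = (4 + t) * 2 ^ L ∧ σ 7 = T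

variable {L s w S : ℕ} {P : Finset (ℕ × ℕ)} {m : ℕ → ℕ}

theorem exec_turnQuery {a b c d t T : ℕ} (hw : 8 * 2 ^ L < 2 ^ w) (ht : t < 4)
    (hab : Bounds (2 ^ L) a b) {σ : ℕ → ℕ} (hσ : TurnState L σ a b c d t T) :
    ∃ σ', Exec w S m turnQuery σ 50 σ' ∧
      TurnState L σ' c d (2 ^ L - 1 - b) (2 ^ L - 1 - a) (t + 1) T := by
  obtain ⟨h0, h1, h2, h3, h4, h5, h6, h7⟩ := hσ
  obtain ⟨hab₁, hb, -⟩ := hab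
  have ht' : (4 + t) * 2 ^ L + 2 ^ L ≤ 8 * 2 ^ L := by nlinarith [Nat.two_pow_pos L]
  refine ⟨_, ((Exec.assign ?_).seq ((Exec.assign ?_).seq ((Exec.assign ?_).seq ((Exec.assign ?_).seq
    ((Exec.assign ?_).seq ((Exec.assign ?_).seq (Exec.assign ?_))))))).mono ?_, ?_⟩
  · simp [Expr.Safe]
  · simp [Expr.Safe]
  · simp [Expr.Safe]
  · simp [Expr.Safe]
  · simp [Expr.Safe, Expr.eval, BinOp.NoOverflow, BinOp.natEval, h1, h5, -Nat.one_lt_two_pow_iff]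
    omega
  · simp [Expr.Safe, Expr.eval, BinOp.NoOverflow, BinOp.natEval, h0, h5, -Nat.one_lt_two_pow_iff]
    omega
  · simp [Expr.Safe, Expr.eval, BinOp.NoOverflow, BinOp.natEval, h5, h6]
    omega
  · simp [Expr.len]
  · simp [TurnState, Expr.eval, BinOp.natEval, h0, h1, h2, h3, h4, h5, h6, h7]
    ring

/-- `τ` approximates `k` with relative error `4 / 2 ^ s`. -/
def Approx (s τ k : ℕ) : Prop :=
  2 ^ s * τ ≤ (2 ^ s + 4) * k ∧ 2 ^ s * k ≤ 2 ^ s * τ + 4 * k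

/-- One round: count in the copy of the current turn, then turn the query. The split levels are
returned relative to the unshifted bounds so that rounds can be compared. -/
theorem exec_countLowerPart_turn (hL : 2 ≤ L)
    (hP : ∀ p ∈ P, 4 * p.1 + 1 < 2 ^ L ∧ 4 * p.2 + 1 < 2 ^ L) (hl : Layout L s w (copies L P) S m)
    (hw : 8 * S < 2 ^ w) (hs : 2 ≤ s) {k : ℕ} (hk : L ≤ 2 ^ k)
    (hk' : ∀ u v, sizeLog (cell L (copies L P) u v) * 2 ^ s ≤ 2 ^ k) {a b c d t T : ℕ}
    (ht : t < 4) (hab : Bounds (2 ^ L) a b) (hcd : Bounds (2 ^ L) c d) {σ : ℕ → ℕ}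
    (hσ : TurnState L σ a b c d t T) (hT : T + S < 2 ^ w) :
    ∃ σ' l j τ, Exec w S m (.seq (countLowerPart s) turnQuery) σ (650 * (k + 1)) σ' ∧
      TurnState L σ' c d (2 ^ L - 1 - b) (2 ^ L - 1 - a) (t + 1) (T + τ) ∧ τ ≤ S ∧
      (l < L ∧ SplitLevel a b l) ∧ (j < L ∧ SplitLevel c d j) ∧
      Approx s τ #(P.filter fun p => InLower a l (turnedPoint (2 ^ L) t p).1 ∧
        InLower c j (turnedPoint (2 ^ L) t p).2) := by
  have hLS := hl.leaves_le
  have hσ' := hσ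
  obtain ⟨h0, h1, h2, h3, h4, h5, h6, h7⟩ := hσ
  have w₁ : 2 ^ (L + 1) = 2 * 2 ^ L := by ring
  have w₂ : 2 ^ (L + 2) = 4 * 2 ^ L := by ring
  have w₃ : 2 ^ (L + 3) = 8 * 2 ^ L := by ring
  have w₄ : (4 + t) * 2 ^ L = 4 * 2 ^ L + t * 2 ^ L := by ring
  have w₅ : t * 2 ^ L ≤ 3 * 2 ^ L := Nat.mul_le_mul_right _ (by omega)
  obtain ⟨z, hz⟩ : 4 ∣ 2 ^ L := pow_dvd_pow 2 hL
  have w₆ : (4 + t) * 2 ^ L = 4 * ((4 + t) * z) := by rw [hz]; ring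
  unfold Bounds at hab hcd
  have div_eq : ∀ t x y, x < 2 ^ L → y < 2 ^ L →
      (t * 2 ^ L + x) / 2 ^ L = (t * 2 ^ L + y) / 2 ^ L := by
    intro t x y hx hy
    rw [shift_div _ _ le_rfl, shift_div _ _ le_rfl, Nat.div_eq_of_lt hx, Nat.div_eq_of_lt hy]
  have hCD := div_eq 1 c d (by omega) (by omega)
  rw [one_mul] at hCD
  obtain ⟨σ₁, l, j, τ, hex, hlow, h7', hτ, ⟨hlL, hsl⟩, ⟨hjL, hsj⟩, happ⟩ :=
    exec_countLowerPart (areLeaves_copies hL hP) hl hw hs (A := (4 + t) * 2 ^ L + a)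
      (B := (4 + t) * 2 ^ L + b) (C := 2 ^ L + c) (D := 2 ^ L + d) (k := k) (σ := σ)
      (by omega) (by omega) (by omega) (by omega) (by omega) (by omega) (by omega)
      (div_eq _ _ _ (by omega) (by omega)) (by omega) hCD (ne_of_mem_copies hL hP (by omega)) hk hk'
      h4 (by rw [h6, h0]) (by rw [h6, h1]) (by rw [h5, h2]) (by rw [h5, h3]) (by rwa [h7])
  rw [card_lowerPart_copies hL hP ht (by omega) hlL.le hjL.le] at happ
  have hσ₁ : TurnState L σ₁ a b c d t (T + τ) := by
    refine ⟨?_, ?_, ?_, ?_, ?_, ?_, ?_, ?_⟩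
    on_goal 8 => rw [h7', h7]
    all_goals rw [hlow _ (by norm_num)]; assumption
  obtain ⟨σ₂, hex₂, hσ₂⟩ := exec_turnQuery (w := w) (S := S) (m := m) (by omega) ht
    (by unfold Bounds; omega) hσ₁
  have hsj' : SplitLevel (1 * 2 ^ L + c) (1 * 2 ^ L + d) j := by simpa using hsj
  exact ⟨σ₂, l, j, τ, (hex.seq hex₂).mono (by omega), hσ₂, hτ, ⟨hlL, hsl.of_shift hlL⟩,
    ⟨hjL, hsj'.of_shift hjL⟩, happ⟩

/-- Load the height of the tree and refine the query. -/
def prepare : Cmd :=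
  .seq (.assign 4 (.load (.lit 0)))
  (.seq (.assign 5 (.bin .shl (.lit 1) (.var 4)))
  (.seq (.assign 6 (.bin .shl (.var 5) (.lit 2)))
  (.seq (.assign 0 (.bin .shl (.var 0) (.lit 2)))
  (.seq (.assign 1 (.bin .add (.bin .shl (.var 1) (.lit 2)) (.lit 3)))
  (.seq (.assign 2 (.bin .shl (.var 2) (.lit 2)))
    (.assign 3 (.bin .add (.bin .shl (.var 3) (.lit 2)) (.lit 3))))))))

theorem exec_prepare {a b c d : ℕ} (hl : Layout L s w P S m) (hw : 8 * S < 2 ^ w)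
    (ha : 4 * a < 2 ^ L) (hb : 4 * b + 3 < 2 ^ L) (hc : 4 * c < 2 ^ L) (hd : 4 * d + 3 < 2 ^ L) :
    ∃ σ', Exec w S m prepare (startVars a b c d) 50 σ' ∧
      TurnState L σ' (4 * a) (4 * b + 3) (4 * c) (4 * d + 3) 0 0 := by
  have hLS := hl.leaves_le
  have hpos : 0 < 2 ^ L := by positivity
  have h0 := hl.height
  refine ⟨_, ((Exec.assign ?_).seq ((Exec.assign ?_).seq ((Exec.assign ?_).seq ((Exec.assign ?_).seq
    ((Exec.assign ?_).seq ((Exec.assign ?_).seq (Exec.assign ?_))))))).mono ?_, ?_⟩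
  · simp only [Expr.Safe, Expr.eval]; omega
  · simp [Expr.Safe, Expr.eval, BinOp.NoOverflow, h0, -Nat.one_lt_two_pow_iff]
    omega
  · simp [Expr.Safe, Expr.eval, BinOp.NoOverflow, BinOp.natEval, h0]; omega
  · simp [Expr.Safe, Expr.eval, BinOp.NoOverflow, startVars]; omega
  · simp [Expr.Safe, Expr.eval, BinOp.NoOverflow, BinOp.natEval, startVars]; omega
  · simp [Expr.Safe, Expr.eval, BinOp.NoOverflow, startVars]; omega
  · simp [Expr.Safe, Expr.eval, BinOp.NoOverflow, BinOp.natEval, startVars]; omega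
  · simp [Expr.len]
  · simp [TurnState, Expr.eval, BinOp.natEval, h0, startVars]
    omega

/-- The query algorithm. -/
def query (s : ℕ) : Cmd :=
  .seq (.ifLt (.var 1) (.var 0) .skip (.ifLt (.var 3) (.var 2) .skip
    (.seq prepare
    (.seq (.seq (countLowerPart s) turnQuery)
    (.seq (.seq (countLowerPart s) turnQuery)
    (.seq (.seq (countLowerPart s) turnQuery) (.seq (countLowerPart s) turnQuery)))))))
    (.assign 0 (.var 7))

theorem exec_query (hL : 2 ≤ L)
    (hP : ∀ p ∈ P, 4 * p.1 + 1 < 2 ^ L ∧ 4 * p.2 + 1 < 2 ^ L) (hl : Layout L s w (copies L P) S m)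
    (hw : 8 * S < 2 ^ w) (hs : 2 ≤ s) {k : ℕ} (hk : L ≤ 2 ^ k)
    (hk' : ∀ u v, sizeLog (cell L (copies L P) u v) * 2 ^ s ≤ 2 ^ k) {a b c d : ℕ}
    (ha : 4 * a + 3 < 2 ^ L) (hb : 4 * b + 3 < 2 ^ L) (hc : 4 * c + 3 < 2 ^ L)
    (hd : 4 * d + 3 < 2 ^ L) :
    ∃ σ', Exec w S m (query s) (startVars a b c d) (2700 * (k + 1)) σ' ∧
      Approx s (σ' 0) (rangeCount P a b c d) := by
  by_cases hab : b < a
  · have e := Exec.ifLt_true (w := w) (S := S) (m := m) (x := .var 1) (y := .var 0)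
      (s := startVars a b c d) (c₂ := (.ifLt (.var 3) (.var 2) .skip
        (.seq prepare
        (.seq (.seq (countLowerPart s) turnQuery)
        (.seq (.seq (countLowerPart s) turnQuery)
        (.seq (.seq (countLowerPart s) turnQuery) (.seq (countLowerPart s) turnQuery)))))))
      (by simp [Expr.Safe]) (by simp [Expr.Safe]) hab (Exec.skip _)
    refine ⟨_, (e.seq (Exec.assign (x := 0) (e := .var 7) (by simp [Expr.Safe]))).mono ?_, ?_⟩
    · simp only [Expr.len]; omega
    · simp [Approx, Expr.eval, startVars, rangeCount, Finset.Icc_eq_empty_of_lt hab]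
  by_cases hcd : d < c
  · have e := Exec.ifLt_true (w := w) (S := S) (m := m) (x := .var 3) (y := .var 2)
      (s := startVars a b c d) (c₂ := (.seq prepare
        (.seq (.seq (countLowerPart s) turnQuery)
        (.seq (.seq (countLowerPart s) turnQuery)
        (.seq (.seq (countLowerPart s) turnQuery) (.seq (countLowerPart s) turnQuery))))))
      (by simp [Expr.Safe]) (by simp [Expr.Safe]) hcd (Exec.skip _)
    have e' := Exec.ifLt_false (x := .var 1) (y := .var 0) (c₁ := .skip) (m := m)
      (s := startVars a b c d) (by simp [Expr.Safe])
      (by simp [Expr.Safe]) hab e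
    refine ⟨_, (e'.seq (Exec.assign (x := 0) (e := .var 7) (by simp [Expr.Safe]))).mono ?_, ?_⟩
    · simp only [Expr.len]; omega
    · simp [Approx, Expr.eval, startVars, rangeCount, Finset.Icc_eq_empty_of_lt hcd]
  push Not at hab hcd
  have hLS := hl.leaves_le
  have bab : Bounds (2 ^ L) (4 * a) (4 * b + 3) := by unfold Bounds; omega
  have bcd : Bounds (2 ^ L) (4 * c) (4 * d + 3) := by unfold Bounds; omega
  have cancel : ∀ x < 2 ^ L, 2 ^ L - 1 - (2 ^ L - 1 - x) = x := fun x hx => by omega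
  obtain ⟨σ₀, e₀, hσ₀⟩ := exec_prepare (a := a) (b := b) (c := c) (d := d) hl hw (by omega) hb
    (by omega) hd
  obtain ⟨σ₁, l₁, j₁, τ₁, e₁, hσ₁, hτ₁, ⟨hl₁, hsl₁⟩, ⟨hj₁, hsj₁⟩, a₁⟩ :=
    exec_countLowerPart_turn hL hP hl hw hs hk hk' (t := 0) (by norm_num) bab bcd hσ₀ (by omega)
  obtain ⟨σ₂, l₂, j₂, τ₂, e₂, hσ₂, hτ₂, ⟨hl₂, hsl₂⟩, ⟨hj₂, hsj₂⟩, a₂⟩ :=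
    exec_countLowerPart_turn hL hP hl hw hs hk hk' (t := 1) (by norm_num) bcd (bab.complement hL)
      hσ₁ (by omega)
  obtain ⟨σ₃, l₃, j₃, τ₃, e₃, hσ₃, hτ₃, ⟨hl₃, hsl₃⟩, ⟨hj₃, hsj₃⟩, a₃⟩ :=
    exec_countLowerPart_turn hL hP hl hw hs hk hk' (t := 2) (by norm_num) (bab.complement hL)
      (bcd.complement hL) hσ₂ (by omega)
  -- Two reflections restore the original bounds of the first coordinate.
  rw [cancel _ (by omega), cancel _ (by omega)] at hσ₃
  obtain ⟨σ₄, l₄, j₄, τ₄, e₄, hσ₄, hτ₄, ⟨hl₄, hsl₄⟩, ⟨hj₄, hsj₄⟩, a₄⟩ :=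
    exec_countLowerPart_turn hL hP hl hw hs hk hk' (t := 3) (by norm_num) (bcd.complement hL)
      bab hσ₃ (by omega)
  have e := Exec.ifLt_false (x := .var 3) (y := .var 2) (c₁ := .skip) (m := m)
      (s := startVars a b c d) (by simp [Expr.Safe])
    (by simp [Expr.Safe]) hcd.not_gt (e₀.seq (e₁.seq (e₂.seq (e₃.seq e₄))))
  have e' := Exec.ifLt_false (x := .var 1) (y := .var 0) (c₁ := .skip) (m := m)
      (s := startVars a b c d) (by simp [Expr.Safe])
    (by simp [Expr.Safe]) hab.not_gt e
  refine ⟨_, (e'.seq (Exec.assign (x := 0) (e := .var 7) (by simp [Expr.Safe]))).mono ?_, ?_⟩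
  · simp only [Expr.len]; omega
  -- Each round finds split levels for exchanged or reflected intervals; by uniqueness they are
  -- those of the first round, so the four parts fit together.
  · have u₁ := (hsj₂.of_complement hj₂ (by omega) hb).unique hsl₁
    have u₂ := (hsl₃.of_complement hl₃ (by omega) hb).unique hsl₁
    have u₃ := hsj₄.unique hsl₁
    have v₁ := hsl₂.unique hsj₁
    have v₂ := (hsj₃.of_complement hj₃ (by omega) hd).unique hsj₁
    have v₃ := (hsl₄.of_complement hl₄ (by omega) hd).unique hsj₁
    subst u₁ u₂ u₃ v₁ v₂ v₃
    rw [rangeCount_eq_sum hP hab hcd hb hd hl₁ hj₁ hsl₁ hsj₁]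
    have h7 : σ₄ 7 = 0 + τ₁ + τ₂ + τ₃ + τ₄ := hσ₄.2.2.2.2.2.2.2
    simp only [Approx, Expr.eval, Function.update_self, h7] at *
    obtain ⟨a₁, a₁'⟩ := a₁
    obtain ⟨a₂, a₂'⟩ := a₂
    obtain ⟨a₃, a₃'⟩ := a₃
    obtain ⟨a₄, a₄'⟩ := a₄
    constructor <;> nlinarith

end WordRAM

/-! ### Logarithmic estimates and conclusion -/

theorem Real.one_lt_log_three : 1 < Real.log 3 := by
  rw [Real.lt_log_iff_exp_lt (by norm_num)]
  exact Real.exp_one_lt_d9.trans (by norm_num)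

/-- The height of the tree is at most logarithmic. -/
theorem log_two_add_three_le {n : ℕ} (hn : 3 ≤ n) :
    ((Nat.log 2 n + 3 : ℕ) : ℝ) ≤ 5 * Real.log n := by
  have h1 : 1 < Real.log n := Real.one_lt_log_three.trans_le
    (Real.log_le_log (by norm_num) (by exact_mod_cast hn))
  have h2 : (Nat.log 2 n : ℝ) * Real.log 2 ≤ Real.log n := by
    rw [← Real.log_pow]
    refine Real.log_le_log (by positivity) ?_
    exact_mod_cast Nat.pow_log_le_self 2 (by omega : n ≠ 0)
  have h3 := Real.log_two_gt_d9
  have h4 : (0 : ℝ) ≤ Nat.log 2 n := Nat.cast_nonneg _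
  push_cast
  nlinarith

/-- The number of rounds of a binary search over the height of the tree. -/
theorem log_log_le {n : ℕ} (hn : 3 ≤ n) :
    (Nat.log 2 (Nat.log 2 n + 3) : ℝ) ≤ 2 * (2 + Real.log (Real.log n)) := by
  have h1 : 1 < Real.log n := Real.one_lt_log_three.trans_le
    (Real.log_le_log (by norm_num) (by exact_mod_cast hn))
  have h2 : (Nat.log 2 (Nat.log 2 n + 3) : ℝ) * Real.log 2 ≤ Real.log (Nat.log 2 n + 3 : ℕ) := by
    rw [← Real.log_pow]
    refine Real.log_le_log (by positivity) ?_
    exact_mod_cast Nat.pow_log_le_self 2 (by omega)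
  have h3 := Real.log_le_log (by positivity) (log_two_add_three_le hn)
  rw [Real.log_mul (by norm_num) (by linarith)] at h3
  have h4 : Real.log 5 ≤ 2 := by
    rw [Real.log_le_iff_le_exp (by norm_num)]
    have := Real.exp_one_gt_d9
    have e : Real.exp 2 = Real.exp 1 * Real.exp 1 := by rw [← Real.exp_add]; norm_num
    rw [e]
    nlinarith
  have h5 := Real.log_two_gt_d9
  have h6 : (0 : ℝ) ≤ Nat.log 2 (Nat.log 2 n + 3) := Nat.cast_nonneg _
  nlinarith

theorem spaceBound_le {n N s : ℕ} (hn : 3 ≤ n) (hN : N ≤ 4 * n) :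
    (spaceBound (Nat.log 2 n + 3) s N : ℝ) ≤ 10000 * 2 ^ s * n * Real.log n ^ 2 := by
  set L := Nat.log 2 n + 3 with hL
  have h1 : 2 ^ L ≤ 8 * n := by
    rw [hL, pow_add]
    have := Nat.pow_log_le_self 2 (by omega : n ≠ 0)
    omega
  have h2 : 3 ≤ L := by omega
  have h3 : 1 ≤ 2 ^ s := Nat.one_le_two_pow
  have h4 : spaceBound L s N ≤ 400 * (2 ^ s * n * L ^ 2) := by
    have h5 : 9 ≤ L ^ 2 := by nlinarith
    have h6 : N * L ^ 2 ≤ 4 * n * L ^ 2 := Nat.mul_le_mul_right _ hN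
    have h7 : 9 * n ≤ n * L ^ 2 := by nlinarith
    have h8 : n * L ^ 2 ≤ 2 ^ s * n * L ^ 2 := by
      rw [mul_assoc]
      exact Nat.le_mul_of_pos_left _ (by positivity)
    have h9 : 29 * 2 ^ s * (N * L ^ 2 + 1) ≤ 29 * 2 ^ s * (5 * (n * L ^ 2)) :=
      Nat.mul_le_mul_left _ (by nlinarith)
    have h10 : 29 * 2 ^ s * (5 * (n * L ^ 2)) = 145 * (2 ^ s * n * L ^ 2) := by ring
    rw [spaceBound]
    omega
  have h5 := log_two_add_three_le hn
  rw [← hL] at h5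
  calc (spaceBound L s N : ℝ) ≤ 400 * (2 ^ s * n * L ^ 2) := by exact_mod_cast h4
    _ ≤ 400 * (2 ^ s * n * (5 * Real.log n) ^ 2) := by gcongr
    _ = _ := by ring

theorem theorem4 (ε : ℝ) (hε : 0 < ε) :
    ∃ (C : ℝ) (prog : WordRAM.Program),
      ∀ n : ℕ, 3 ≤ n →
      ∀ w : ℕ, C * (n : ℝ) * (Real.log n) ^ 2 ≤ (2 : ℝ) ^ w →
      ∀ P : Finset (ℕ × ℕ), P ⊆ Finset.Icc 1 n ×ˢ Finset.Icc 1 n → P.card ≤ n →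
      ∃ S : ℕ, (S : ℝ) ≤ C * (n : ℝ) * (Real.log n) ^ 2 ∧
      ∃ mem : Fin S → BitVec w,
      ∀ a ∈ Finset.Icc 1 n, ∀ b ∈ Finset.Icc 1 n, ∀ c ∈ Finset.Icc 1 n, ∀ d ∈ Finset.Icc 1 n,
      ∃ k : ℕ,
        WordRAM.Answers prog mem a b c d (C * Real.log (Real.log n)) k ∧
        (1 - ε) * (rangeCount P a b c d : ℝ) ≤ (k : ℝ) ∧
        (k : ℝ) ≤ (1 + ε) * (rangeCount P a b c d : ℝ) := by
  obtain ⟨s, hs, hsε⟩ : ∃ s : ℕ, 2 ≤ s ∧ 4 ≤ ε * 2 ^ s := by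
    obtain ⟨s, hs⟩ := pow_unbounded_of_one_lt (4 / ε) (one_lt_two (α := ℝ))
    refine ⟨s + 2, by omega, ?_⟩
    rw [div_lt_iff₀ hε] at hs
    have : (2 : ℝ) ^ (s + 2) = 4 * 2 ^ s := by ring
    rw [this]
    nlinarith
  set y₀ := Real.log (Real.log 3) with hy₀
  have hy₀_pos : 0 < y₀ := Real.log_pos Real.one_lt_log_three
  -- The first term covers space, with room for the factor `8` in the word length. The second covers
  -- time: additive constants are absorbed since `log (log n) ≥ y₀ > 0`.
  refine ⟨100000 * 2 ^ s + 2700 * (2 + (s + 6) / y₀), (WordRAM.query s).code 0 ++ [.halt], ?_⟩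
  intro n hn w hw P hP hcard
  have hlog : Real.log 3 ≤ Real.log n := Real.log_le_log (by norm_num) (by exact_mod_cast hn)
  have hlog₁ : 1 < Real.log n := Real.one_lt_log_three.trans_le hlog
  have hy : y₀ ≤ Real.log (Real.log n) :=
    Real.log_le_log (by linarith [Real.one_lt_log_three]) hlog
  have hn₀ : (0 : ℝ) < n := by exact_mod_cast (by omega : 0 < n)
  have hC : (100000 : ℝ) * 2 ^ s ≤ 100000 * 2 ^ s + 2700 * (2 + (s + 6) / y₀) := by
    have : 0 ≤ (s + 6) / y₀ := by positivity
    linarith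
  have hC' : (100000 : ℝ) * 2 ^ s * n * Real.log n ^ 2 ≤
      (100000 * 2 ^ s + 2700 * (2 + (s + 6) / y₀)) * n * Real.log n ^ 2 := by gcongr
  -- The summand `3` makes room for stretched bounds `4 * b + 3` and for `sizeLog` of cells of the
  -- up to `4 * n` copied points.
  set L := Nat.log 2 n + 3 with hL
  have hnL : 4 * n + 4 ≤ 2 ^ L := by
    rw [hL, pow_add]
    have := Nat.lt_pow_succ_log_self (by norm_num : 1 < 2) n
    rw [pow_succ] at this
    omega
  have hcop : #(copies L P) ≤ 4 * n := card_copies_le.trans (Nat.mul_le_mul_left _ hcard)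
  have hspace := spaceBound_le (s := s) hn hcop
  rw [← hL] at hspace
  have hz : 0 < (2 : ℝ) ^ s * n * Real.log n ^ 2 := by positivity
  have hw' : 8 * spaceBound L s #(copies L P) < 2 ^ w := by
    have : (8 : ℝ) * spaceBound L s #(copies L P) < 2 ^ w := by nlinarith
    exact_mod_cast this
  have hP' : ∀ p ∈ P, 4 * p.1 + 1 < 2 ^ L ∧ 4 * p.2 + 1 < 2 ^ L := by
    intro p hp
    have := hP hp
    simp only [mem_product, mem_Icc] at this
    omega
  obtain ⟨S, m, hS, hl⟩ := exists_layout (L := L) (s := s) (w := w) (by omega)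
    (areLeaves_copies (by omega) hP') (by omega)
  refine ⟨S, ?_, fun i => BitVec.ofNat w (m i), ?_⟩
  · have : (S : ℝ) ≤ spaceBound L s #(copies L P) := by exact_mod_cast hS
    nlinarith
  intro a ha b hb c hc d hd
  rw [mem_Icc] at ha hb hc hd
  have hSL := hl.leaves_le
  -- Every search range has length at most `L * 2 ^ s ≤ 2 ^ k`, so `k` bounds the number of rounds.
  set k := Nat.log 2 L + 1 + s with hk
  have hk₁ : L * 2 ^ s ≤ 2 ^ k := by
    rw [hk, pow_add]
    exact Nat.mul_le_mul_right _ (Nat.lt_pow_succ_log_self (by norm_num) L).le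
  have hk₂ : ∀ u v, sizeLog (cell L (copies L P) u v) * 2 ^ s ≤ 2 ^ k := by
    intro u v
    refine le_trans (Nat.mul_le_mul_right _ ?_) hk₁
    have h₁ : #(cell L (copies L P) u v) ≤ n * 2 * 2 :=
      (card_filter_le _ _).trans (hcop.trans (by omega))
    have h₂ := Nat.log_mono_right (b := 2) h₁
    rw [Nat.log_mul_base (by norm_num) (by omega), Nat.log_mul_base (by norm_num) (by omega)] at h₂
    rw [sizeLog]
    omega
  obtain ⟨σ, hex, happ₁, happ₂⟩ := WordRAM.exec_query (a := a) (b := b) (c := c) (d := d)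
    (by omega) hP' hl (by omega) hs ((Nat.le_mul_of_pos_right _ (by positivity)).trans hk₁) hk₂
    (by omega) (by omega) (by omega) (by omega)
  have hans := WordRAM.answers_of_exec (by omega) (by omega) (by omega) (by omega)
    hl.lt_two_pow hex
  refine ⟨σ 0, ?_, ?_, ?_⟩
  · obtain ⟨t, final, ht, hrest⟩ := hans
    refine ⟨t, final, ht.trans ?_, hrest⟩
    have h₁ := log_log_le hn
    rw [← hL] at h₁
    have h₂ : (s + 6 : ℝ) ≤ (s + 6) / y₀ * Real.log (Real.log n) := by
      rw [div_mul_eq_mul_div, le_div_iff₀ hy₀_pos]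
      gcongr
    have h₃ : 0 ≤ 100000 * 2 ^ s * Real.log (Real.log n) := by
      have : 0 ≤ Real.log (Real.log n) := hy₀_pos.le.trans hy
      positivity
    rw [hk]
    push_cast
    nlinarith
  · have h : (2 : ℝ) ^ s * rangeCount P a b c d ≤ 2 ^ s * σ 0 + 4 * rangeCount P a b c d := by
      exact_mod_cast happ₂
    have hr : (0 : ℝ) ≤ rangeCount P a b c d := Nat.cast_nonneg _
    have h₁ := mul_le_mul_of_nonneg_right hsε hr
    have hpos : (0 : ℝ) < 2 ^ s := by positivity
    refine le_of_mul_le_mul_left ?_ hpos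
    linarith
  · have h : (2 : ℝ) ^ s * σ 0 ≤ (2 ^ s + 4) * rangeCount P a b c d := by
      exact_mod_cast happ₁
    have hr : (0 : ℝ) ≤ rangeCount P a b c d := Nat.cast_nonneg _
    have h₁ := mul_le_mul_of_nonneg_right hsε hr
    have hpos : (0 : ℝ) < 2 ^ s := by positivity
    refine le_of_mul_le_mul_left ?_ hpos
    linarith
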